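/- Let $B_{3,1}$ be the graph consisting of two triangles sharing exactly one vertex. For graphs $H,G$ let $\mathcal N(H,G)$ be the number of (unlabeled, not necessarily induced) copies of $H$ in $G$, that is, the number of subgraphs of $G$ isomorphic to $H$, and let $\mathrm{ex}(n,H,F)$ be the maximum of $\mathcal N(H,G)$ over all $n$-vertex graphs $G$ that do not contain $F$ as a (not necessarily induced) subgraph. For all integers $1\le a\le b$ there is an $n_0=n_0(a,b)$ such that for every $n\ge n_0$ there exists an $n$-vertex graph $T$, obtained from a complete bipartite graph (with nonempty parts) by adding one edge between two distinct non-adjacent vertices, such that $$\mathrm{ex}(n,K_{a,b},B_{3,1})=\mathcal N(K_{a,b},T).$$ -/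

import Mathlib

namespace GenTuran

/-- The generalized book graph `B_{r,s}` (for `s ≤ r`): two cliques of size `r` sharing exactly `s`
vertices. The vertices in `Fin s` are the shared (rootlet) vertices, and the two copies of
`Fin (r - s)` are the two pages. Two distinct vertices are adjacent unless they lie on different
pages. -/
def book (r s : ℕ) : SimpleGraph (Fin s ⊕ (Fin (r - s) ⊕ Fin (r - s))) where
  Adj x y := x ≠ y ∧
    ¬ ∃ i j : Fin (r - s),
      (x = Sum.inr (Sum.inl i) ∧ y = Sum.inr (Sum.inr j)) ∨
      (x = Sum.inr (Sum.inr i) ∧ y = Sum.inr (Sum.inl j))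
  symm := ⟨by
    rintro x y ⟨hne, h⟩
    refine ⟨hne.symm, ?_⟩
    rintro ⟨i, j, ⟨h1, h2⟩ | ⟨h1, h2⟩⟩
    · exact h ⟨j, i, Or.inr ⟨h2, h1⟩⟩
    · exact h ⟨j, i, Or.inl ⟨h2, h1⟩⟩⟩
  loopless := ⟨fun _ h => h.1 rfl⟩

open scoped Classical in
/-- The generalized Turán number `ex(n, H, F)`: the maximum of `N(H, G)`, the number of subgraphs of
`G` isomorphic to `H`, over all `F`-free graphs `G` on `n` vertices. -/
noncomputable def ex (n : ℕ) {U W : Type*} (H : SimpleGraph U) (F : SimpleGraph W) : ℕ :=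
  (Finset.univ.filter fun G : SimpleGraph (Fin n) => F.Free G).sup fun G => G.copyCount H

/-- `T` is obtained from a complete bipartite graph, with nonempty parts `S` and `Sᶜ`, by adding one
edge `uv` that was not there before. -/
def IsCompleteBipartitePlusEdge {V : Type*} (T : SimpleGraph V) : Prop :=
  ∃ S : Set V, S.Nonempty ∧ Sᶜ.Nonempty ∧
    ∃ u v : V, u ≠ v ∧ ¬ ((⊤ : SimpleGraph V).between S Sᶜ).Adj u v ∧
      T = (⊤ : SimpleGraph V).between S Sᶜ ⊔ SimpleGraph.edge u v

end GenTuran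

/-!
# Copies of `K_{a,b}` in bowtie-free graphs

For large `n`, a bowtie-free graph on `n` vertices with the most copies of `K_{a,b}` has no more of
them than some complete bipartite graph with one added edge. As such a graph is itself bowtie-free,
this gives the generalized Turán number. Unlabelled copies are `1 / |Aut K_{a,b}|` times the labelled
ones, which are counted as pairs of tuples (`bicliques`).

*Stability.* Let `Δ` be the maximum degree of an extremal graph `G`. The neighbourhood of a vertex of
degree `Δ` contains no two disjoint edges, so up to two vertices it is an independent set `Y`. Every
copy of `K_{a,b}` then has a side inside the complement `X` of `Y`, and, no degree exceeding `Δ`, the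
copies with a given side in `X` are at most as many as in a complete bipartite graph with parts of
sizes `|X|` and `Δ` (`card_bicliques_add_card_homTuples_le`, which extends Erdős' majorization of
degree sequences). The complete bipartite graph with parts `X` and `Y` shows that this bound is tight
up to a factor `1 - O(1/n)`. Hence the total degree deficiency of the vertices of `X` is `O(n)`, and
there are so few copies inside `X` that, by supersaturation, `X` spans `o(n²)` edges. So almost all
pairs between `X` and `Y` are edges (`exists_almost_complete_bipartition`).

*All vertices are typical.* Almost all vertices lie in two independent sets `P`, `Q`, each vertex of
either being joined to almost all of the other (`exists_good_pair`). Any vertex `v` has few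
neighbours in one of the two sets, say in `P`, as it would otherwise be the centre of a bowtie.
Replacing its neighbourhood by `Q` leaves the graph bowtie-free, and would create more copies than it
destroys unless `v` is already joined to almost all of `Q` (`card_nonneighbors_mul_le`).

*Exact structure.* Now all vertices are split into two classes, each vertex being joined to almost
all of a large set in the other class, and two edges inside one class would span a bowtie with their
common neighbours. If at most one edge lies inside the classes, `G` is contained in a complete
bipartite graph with one edge added. If there is one in each class, then avoiding bowties costs cross
edges, and trading one of the two inner edges for all missing cross edges does not decrease the
number of copies (`card_bicliques_le_of_two_inner_edges`).
-/

namespace GenTuran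

open Finset Function SimpleGraph

/-! ### Copies of a complete bipartite graph -/

theorem labelledCopyCount_eq_natCard {V W : Type*} [Fintype V] [Fintype W]
    (G : SimpleGraph V) (H : SimpleGraph W) : G.labelledCopyCount H = Nat.card (Copy H G) := by
  classical
  rw [labelledCopyCount, ← Nat.card_eq_fintype_card]

open scoped Classical in
/-- Sending an isomorphism of `H` onto a subgraph of `G` to the labelled copy it gives is a
bijection, so labelled copies are the unlabelled ones counted with multiplicity `|Aut H|`. -/
theorem labelledCopyCount_eq_copyCount_mul {V W : Type*} [Fintype V] [Fintype W]
    (G : SimpleGraph V) (H : SimpleGraph W) :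
    G.labelledCopyCount H = G.copyCount H * Nat.card (H ≃g H) := by
  let F : (Σ G' : G.Subgraph, (H ≃g G'.coe)) → Copy H G := fun p => p.1.coeCopy.comp p.2.toCopy
  have hF : ∀ p, (F p).toSubgraph = p.1 := by
    rintro ⟨G', e⟩
    ext x y
    · simp only [F, Copy.toSubgraph, Subgraph.map_verts, Subgraph.verts_top, Set.image_univ,
        Set.mem_range]
      constructor
      · rintro ⟨w, rfl⟩
        exact (e w).2
      · intro hx
        exact ⟨e.symm ⟨x, hx⟩, by
          change ((e (e.symm ⟨x, hx⟩) : G'.verts) : V) = x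
          simp⟩
    · simp only [F, Copy.toSubgraph, Subgraph.map_adj, Relation.Map, Subgraph.top_adj]
      constructor
      · rintro ⟨w, w', h, rfl, rfl⟩
        exact e.map_rel_iff.2 h
      · intro hxy
        refine ⟨e.symm ⟨x, hxy.fst_mem⟩, e.symm ⟨y, hxy.snd_mem⟩, ?_, ?_, ?_⟩
        · exact e.symm.map_rel_iff.2 (by simpa using hxy)
        · change ((e (e.symm ⟨x, _⟩) : G'.verts) : V) = x
          simp
        · change ((e (e.symm ⟨y, _⟩) : G'.verts) : V) = y
          simp
  have hbij : Bijective F := by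
    constructor
    · rintro ⟨G₁, e₁⟩ ⟨G₂, e₂⟩ h
      have h12 : G₁ = G₂ :=
        (hF ⟨G₁, e₁⟩).symm.trans ((congrArg Copy.toSubgraph h).trans (hF ⟨G₂, e₂⟩))
      subst h12
      congr 1
      ext w
      exact DFunLike.congr_fun h w
    · intro f
      exact ⟨⟨f.toSubgraph, f.isoToSubgraph⟩, by ext w; rfl⟩
  have hfib : ∀ G' : G.Subgraph,
      Nat.card (H ≃g G'.coe) = if Nonempty (H ≃g G'.coe) then Nat.card (H ≃g H) else 0 := by
    intro G'
    split_ifs with h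
    · obtain ⟨e⟩ := h
      refine Nat.card_congr ⟨fun f => f.trans e.symm, fun f => f.trans e, fun f => ?_, fun f => ?_⟩
      · ext x; simp
      · ext x; simp
    · rw [not_nonempty_iff] at h
      simp
  have hfin : Finite (Copy H G) := by
    exact Finite.of_injective (fun f : Copy H G => (f : W → V)) DFunLike.coe_injective
  rw [labelledCopyCount_eq_natCard, ← Nat.card_eq_of_bijective F hbij]
  have : ∀ G' : G.Subgraph, Finite (H ≃g G'.coe) := fun G' =>
    Finite.of_injective (fun f : H ≃g G'.coe => (f : W → G'.verts)) DFunLike.coe_injective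
  rw [Nat.card_sigma, Finset.sum_congr rfl (fun G' _ => hfib G'), ← Finset.sum_filter,
    Finset.sum_const, smul_eq_mul, copyCount]

section Copies

variable {V : Type*} [Fintype V]

open scoped Classical in
/-- The labelled copies of `K_{a,b}` in `G`, as pairs of injective tuples that are completely joined
to one another. That the two tuples have disjoint ranges is automatic, as `G` has no loops. -/
noncomputable def bicliques (G : SimpleGraph V) (a b : ℕ) : Finset ((Fin a → V) × (Fin b → V)) :=
  {f | Injective f.1 ∧ Injective f.2 ∧ ∀ i j, G.Adj (f.1 i) (f.2 j)}

theorem mem_bicliques {G : SimpleGraph V} {a b : ℕ} {f : (Fin a → V) × (Fin b → V)} :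
    f ∈ bicliques G a b ↔ Injective f.1 ∧ Injective f.2 ∧ ∀ i j, G.Adj (f.1 i) (f.2 j) := by
  simp [bicliques]

/-- The labelled copy of `K_{a,b}` given by two completely joined tuples. -/
def copyOfTuples {V : Type*} {G : SimpleGraph V} {a b : ℕ} (A : Fin a → V) (B : Fin b → V)
    (hA : Injective A) (hB : Injective B) (h : ∀ i j, G.Adj (A i) (B j)) :
    Copy (completeBipartiteGraph (Fin a) (Fin b)) G where
  toHom :=
    { toFun := Sum.elim A B
      map_rel' := by
        rintro (i | i) (j | j) hij
        · simp at hij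
        · exact h i j
        · exact (h j i).symm
        · simp at hij }
  injective' := Sum.elim_injective.2 ⟨hA, hB, fun i j => (h i j).ne⟩

theorem card_bicliques (G : SimpleGraph V) (a b : ℕ) :
    (bicliques G a b).card = G.labelledCopyCount (completeBipartiteGraph (Fin a) (Fin b)) := by
  have hF : Bijective fun f : bicliques G a b =>
      copyOfTuples f.1.1 f.1.2 (mem_bicliques.1 f.2).1 (mem_bicliques.1 f.2).2.1
        (mem_bicliques.1 f.2).2.2 := by
    constructor
    · intro f g h
      have h1 : ∀ x, Sum.elim f.1.1 f.1.2 x = Sum.elim g.1.1 g.1.2 x :=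
        fun x => DFunLike.congr_fun h x
      exact Subtype.ext (Prod.ext (funext fun i => h1 (Sum.inl i)) (funext fun j => h1 (Sum.inr j)))
    · intro c
      have hc : (fun i => c (Sum.inl i), fun j => c (Sum.inr j)) ∈ bicliques G a b :=
        mem_bicliques.2 ⟨fun i j h => Sum.inl_injective (c.injective h),
          fun i j h => Sum.inr_injective (c.injective h), fun i j => c.toHom.map_adj (by simp)⟩
      refine ⟨⟨_, hc⟩, ?_⟩
      ext (i | i) <;> rfl
  have h1 := Nat.card_eq_of_bijective _ hF
  rw [Nat.card_eq_fintype_card, Fintype.card_coe] at h1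
  rw [h1, labelledCopyCount_eq_natCard]

theorem copyCount_le_copyCount {a b : ℕ} {G T : SimpleGraph V}
    (h : (bicliques G a b).card ≤ (bicliques T a b).card) :
    G.copyCount (completeBipartiteGraph (Fin a) (Fin b)) ≤
      T.copyCount (completeBipartiteGraph (Fin a) (Fin b)) := by
  rw [card_bicliques, card_bicliques, labelledCopyCount_eq_copyCount_mul,
    labelledCopyCount_eq_copyCount_mul] at h
  have : Finite (completeBipartiteGraph (Fin a) (Fin b) ≃g
      completeBipartiteGraph (Fin a) (Fin b)) :=
    Finite.of_injective (fun f => (f : Fin a ⊕ Fin b → Fin a ⊕ Fin b)) DFunLike.coe_injective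
  have : Nonempty (completeBipartiteGraph (Fin a) (Fin b) ≃g
      completeBipartiteGraph (Fin a) (Fin b)) := ⟨Iso.refl⟩
  exact Nat.le_of_mul_le_mul_right h Nat.card_pos

theorem bicliques_mono {G T : SimpleGraph V} (h : G ≤ T) (a b : ℕ) :
    bicliques G a b ⊆ bicliques T a b := by
  intro f hf
  obtain ⟨h1, h2, h3⟩ := mem_bicliques.1 hf
  exact mem_bicliques.2 ⟨h1, h2, fun i j => h (h3 i j)⟩

end Copies

/-! ### Bowties -/

/-- A bowtie is two triangles `c x y` and `c z w` with only the vertex `c` in common. -/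
theorem book_isContained_iff {V : Type*} {G : SimpleGraph V} :
    (book 3 1).IsContained G ↔ ∃ c x y z w, G.Adj c x ∧ G.Adj c y ∧ G.Adj x y ∧
      G.Adj c z ∧ G.Adj c w ∧ G.Adj z w ∧ x ≠ z ∧ x ≠ w ∧ y ≠ z ∧ y ≠ w := by
  constructor
  · rintro ⟨f⟩
    have hadj : ∀ p q, (book 3 1).Adj p q → G.Adj (f p) (f q) := fun p q h => f.toHom.map_adj h
    have hne : ∀ p q, p ≠ q → f p ≠ f q := fun p q h h' => h (f.injective h')
    refine ⟨f (Sum.inl 0), f (Sum.inr (Sum.inl (0 : Fin 2))), f (Sum.inr (Sum.inl (1 : Fin 2))),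
      f (Sum.inr (Sum.inr (0 : Fin 2))), f (Sum.inr (Sum.inr (1 : Fin 2))),
      hadj _ _ ?_, hadj _ _ ?_, hadj _ _ ?_, hadj _ _ ?_, hadj _ _ ?_, hadj _ _ ?_,
      hne _ _ ?_, hne _ _ ?_, hne _ _ ?_, hne _ _ ?_⟩ <;> simp [book]
  · rintro ⟨c, x, y, z, w, hcx, hcy, hxy, hcz, hcw, hzw, h1, h2, h3, h4⟩
    let f : Fin 1 ⊕ (Fin 2 ⊕ Fin 2) → V := Sum.elim (fun _ => c) (Sum.elim ![x, y] ![z, w])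
    have hf : ∀ p q, (book 3 1).Adj p q → G.Adj (f p) (f q) := by
      rintro p q ⟨hpq, h⟩
      rcases p with p | p | p <;> rcases q with q | q | q <;> fin_cases p <;> fin_cases q <;>
        first
        | exact (hpq rfl).elim
        | exact (h ⟨_, _, Or.inl ⟨rfl, rfl⟩⟩).elim
        | exact (h ⟨_, _, Or.inr ⟨rfl, rfl⟩⟩).elim
        | (simp [f]; first | assumption | (apply SimpleGraph.Adj.symm; assumption))
    refine ⟨⟨⟨f, fun h => hf _ _ h⟩, ?_⟩⟩
    intro p q hpq
    change f p = f q at hpq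
    have := hcx.ne
    have := hcy.ne
    have := hcz.ne
    have := hcw.ne
    have := hxy.ne
    have := hzw.ne
    rcases p with p | p | p <;> rcases q with q | q | q <;> fin_cases p <;> fin_cases q <;>
      first
      | rfl
      | (simp [f] at hpq; exact absurd hpq (by first | assumption | (apply Ne.symm; assumption)))

section Counting

open scoped Classical

variable {V : Type*} [Fintype V]

/-! ### Counting tuples -/

theorem card_injective_tuples (P : Finset V) (a : ℕ) :
    #{A : Fin a → V | Injective A ∧ ∀ i, A i ∈ P} = (#P).descFactorial a := by
  have h : Fintype.card (Fin a ↪ P) = (#P).descFactorial a := by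
    rw [Fintype.card_embedding_eq, Fintype.card_coe, Fintype.card_fin]
  rw [← h, ← Finset.card_univ]
  symm
  refine Finset.card_bij (fun e _ i => (e i : V)) ?_ ?_ ?_
  · intro e _
    simp only [mem_filter, mem_univ, true_and]
    exact ⟨Subtype.val_injective.comp e.injective, fun i => (e i).2⟩
  · intro e _ e' _ h
    ext i
    exact congrFun h i
  · intro A hA
    simp only [mem_filter, mem_univ, true_and] at hA
    exact ⟨⟨fun i => ⟨A i, hA.2 i⟩, fun i j h => hA.1 (congrArg Subtype.val h)⟩, mem_univ _, rfl⟩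

/-- If each vertex of `s` has at most `m` non-neighbours in `Q`, then all but at most `|s| * m` vertices
of `Q` are common neighbours of `s`. -/
theorem card_le_card_common_add (G : SimpleGraph V) (s Q : Finset V) (m : ℕ)
    (h : ∀ x ∈ s, #{q ∈ Q | ¬ G.Adj x q} ≤ m) :
    #Q ≤ #{q ∈ Q | ∀ x ∈ s, G.Adj x q} + #s * m := by
  have hsub : Q ⊆ {q ∈ Q | ∀ x ∈ s, G.Adj x q} ∪ s.biUnion fun x => {q ∈ Q | ¬ G.Adj x q} := by
    intro q hq
    by_cases hc : ∀ x ∈ s, G.Adj x q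
    · exact mem_union_left _ (mem_filter.2 ⟨hq, hc⟩)
    · push Not at hc
      obtain ⟨x, hx, hxq⟩ := hc
      exact mem_union_right _ (mem_biUnion.2 ⟨x, hx, mem_filter.2 ⟨hq, hxq⟩⟩)
  exact (card_le_card hsub).trans ((card_union_le _ _).trans
    (Nat.add_le_add_left (card_biUnion_le_card_mul _ _ _ h) _))

/-- Greedy count of the copies of `K_{a+1,b+1}` through a given edge `vy`, whose remaining vertices
are taken from a set `P` of neighbours of `y` and a set `Q` of neighbours of `v` such that the pair
`(P, Q)` is nearly complete. -/
theorem le_card_bicliques_through (G : SimpleGraph V) (a b m : ℕ) {v y : V} {P Q : Finset V}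
    (hvy : G.Adj v y) (hv : v ∉ P) (hy : y ∉ Q) (hP : ∀ x ∈ P, G.Adj x y)
    (hQ : ∀ q ∈ Q, G.Adj v q) (h : ∀ x ∈ P, #{q ∈ Q | ¬ G.Adj x q} ≤ m) :
    (#P - a) ^ a * (#Q - a * m - b) ^ b ≤
      #{f ∈ bicliques G (a + 1) (b + 1) | f.1 0 = v ∧ f.2 0 = y} := by
  let S : Finset (Fin a → V) := {A | Injective A ∧ ∀ i, A i ∈ P}
  let C : (Fin a → V) → Finset V := fun A => {q ∈ Q | ∀ x ∈ univ.image A, G.Adj x q}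
  let T : (Fin a → V) → Finset (Fin b → V) := fun A => {B | Injective B ∧ ∀ j, B j ∈ C A}
  have hS : (#P - a) ^ a ≤ #S := by
    rw [card_injective_tuples]
    exact (Nat.pow_le_pow_left (by omega) a).trans (Nat.pow_sub_le_descFactorial _ _)
  have hT : ∀ A ∈ S, (#Q - a * m - b) ^ b ≤ #(T A) := by
    intro A hA
    simp only [S, mem_filter, mem_univ, true_and] at hA
    rw [card_injective_tuples]
    refine le_trans (Nat.pow_le_pow_left ?_ b) (Nat.pow_sub_le_descFactorial _ _)
    have h1 := card_le_card_common_add G (univ.image A) Q m (by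
      intro x hx
      obtain ⟨i, -, rfl⟩ := mem_image.1 hx
      exact h _ (hA.2 i))
    have h2 : #(univ.image A) ≤ a := card_image_le.trans (by simp)
    have h3 := Nat.mul_le_mul_right m h2
    change #Q ≤ #(C A) + _ at h1
    omega
  have hsig : (#P - a) ^ a * (#Q - a * m - b) ^ b ≤ #(S.sigma T) := by
    rw [card_sigma]
    calc _ ≤ #S * (#Q - a * m - b) ^ b := Nat.mul_le_mul_right _ hS
      _ = ∑ A ∈ S, (#Q - a * m - b) ^ b := by simp
      _ ≤ _ := sum_le_sum hT
  refine hsig.trans (card_le_card_of_injOn (fun p => (Fin.cons v p.1, Fin.cons y p.2)) ?_ ?_)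
  · rintro ⟨A, B⟩ hp
    simp only [coe_sigma, Set.mem_sigma_iff, mem_coe, S, T, C, mem_filter, mem_univ,
      true_and] at hp
    obtain ⟨⟨hA1, hA2⟩, hB1, hB2⟩ := hp
    simp only [mem_coe, mem_filter, Fin.cons_zero, and_self, and_true]
    refine mem_bicliques.2 ⟨?_, ?_, ?_⟩
    · exact Fin.cons_injective_iff.2 ⟨by rintro ⟨i, rfl⟩; exact hv (hA2 i), hA1⟩
    · exact Fin.cons_injective_iff.2 ⟨by rintro ⟨i, rfl⟩; exact hy (hB2 i).1, hB1⟩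
    · intro i j
      refine Fin.cases ?_ (fun i => ?_) i <;> refine Fin.cases ?_ (fun j => ?_) j
      · exact hvy
      · exact hQ _ (hB2 j).1
      · exact hP _ (hA2 i)
      · exact (hB2 j).2 _ (mem_image_of_mem _ (mem_univ i))
  · rintro ⟨A, B⟩ - ⟨A', B'⟩ - hAB
    obtain ⟨h1, h2⟩ := Prod.ext_iff.1 hAB
    have h1' := Fin.cons_right_injective (α := fun _ => V) v h1
    have h2' := Fin.cons_right_injective (α := fun _ => V) y h2
    simp only at h1' h2'
    subst h1' h2'
    rfl

/-- Bounds the copies of `K_{a+1,b+1}` in which the places `i` and `j` are taken by given vertices. -/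
theorem card_tuples_le (a b : ℕ) (i : Fin (a + 1)) (j : Fin (b + 1)) (v w : V) :
    #{f : (Fin (a + 1) → V) × (Fin (b + 1) → V) | f.1 i = v ∧ f.2 j = w} ≤
      Fintype.card V ^ (a + b) := by
  have : Fintype.card V ^ (a + b) = #(univ : Finset ((Fin a → V) × (Fin b → V))) := by
    simp [pow_add]
  rw [this]
  refine card_le_card_of_injOn (fun f => (i.removeNth f.1, j.removeNth f.2)) (by simp) ?_
  rintro ⟨A, B⟩ h ⟨A', B'⟩ h' hAB
  simp only [coe_filter, mem_univ, true_and, Set.mem_ofPred_eq] at h h'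
  obtain ⟨h1, h2⟩ := Prod.ext_iff.1 hAB
  simp only at h1 h2
  refine Prod.ext ?_ ?_
  · rw [← Fin.insertNth_self_removeNth i A, ← Fin.insertNth_self_removeNth i A', h1, h.1, h'.1]
  · rw [← Fin.insertNth_self_removeNth j B, ← Fin.insertNth_self_removeNth j B', h2, h.2, h'.2]

/-- Stars are counted by the degrees of their centres. -/
theorem card_bicliques_one (G : SimpleGraph V) (b : ℕ) :
    #(bicliques G 1 b) = ∑ v, (#{w | G.Adj v w}).descFactorial b := by
  rw [card_eq_sum_card_fiberwise (f := fun f => f.1 0) (t := univ) (by simp)]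
  refine sum_congr rfl fun v _ => ?_
  rw [← card_injective_tuples]
  have hsub : ∀ A : Fin 1 → V, Injective A := fun A => injective_of_subsingleton A
  have hconst : ∀ (A : Fin 1 → V) (i : Fin 1), A i = A 0 := fun A i => by
    rw [Subsingleton.elim i 0]
  refine card_bij (fun f _ => f.2) ?_ ?_ ?_
  · intro f hf
    have hf1 := mem_bicliques.1 (mem_filter.1 hf).1
    have hf2 : f.1 0 = v := (mem_filter.1 hf).2
    refine mem_filter.2 ⟨mem_univ _, hf1.2.1, fun j => mem_filter.2 ⟨mem_univ _, ?_⟩⟩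
    rw [← hf2]
    exact hf1.2.2 0 j
  · intro f hf g hg h
    have hf2 : f.1 0 = v := (mem_filter.1 hf).2
    have hg2 : g.1 0 = v := (mem_filter.1 hg).2
    refine Prod.ext (funext fun i => ?_) h
    rw [hconst f.1 i, hconst g.1 i, hf2, hg2]
  · intro B hB
    have hB := (mem_filter.1 hB).2
    exact ⟨(fun _ => v, B), mem_filter.2 ⟨mem_bicliques.2 ⟨hsub _, hB.1,
      fun _ j => (mem_filter.1 (hB.2 j)).2⟩, rfl⟩, rfl⟩

/-- The complete bipartite graph with parts `P`, `Q` contains the copies of `K_{a,b}` with the side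
of size `a` in `P`, and those with that side in `Q`. -/
theorem le_card_bicliques_of_complete (G : SimpleGraph V) {a b : ℕ} (ha : 1 ≤ a) {P Q : Finset V}
    (hPQ : Disjoint P Q) (h : ∀ x ∈ P, ∀ y ∈ Q, G.Adj x y) :
    (#P).descFactorial a * (#Q).descFactorial b + (#P).descFactorial b * (#Q).descFactorial a ≤
      #(bicliques G a b) := by
  let S : Finset V → ∀ a, Finset (Fin a → V) := fun P a => {A | Injective A ∧ ∀ i, A i ∈ P}
  have key : ∀ (P Q : Finset V), (∀ x ∈ P, ∀ y ∈ Q, G.Adj x y) →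
      S P a ×ˢ S Q b ⊆ bicliques G a b := by
    intro P Q h f hf
    simp only [S, mem_product, mem_filter, mem_univ, true_and] at hf
    exact mem_bicliques.2 ⟨hf.1.1, hf.2.1, fun i j => h _ (hf.1.2 i) _ (hf.2.2 j)⟩
  have hdis : Disjoint (S P a ×ˢ S Q b) (S Q a ×ˢ S P b) := by
    rw [Finset.disjoint_left]
    intro f hf hf'
    simp only [S, mem_product, mem_filter, mem_univ, true_and] at hf hf'
    exact Finset.disjoint_left.1 hPQ (hf.1.2 ⟨0, ha⟩) (hf'.1.2 ⟨0, ha⟩)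
  have := card_le_card (union_subset (key P Q h) (key Q P fun x hx y hy => (h y hy x hx).symm))
  rw [card_union_of_disjoint hdis, card_product, card_product] at this
  simp only [S, card_injective_tuples] at this
  linarith [mul_comm ((#P).descFactorial b) ((#Q).descFactorial a)]

end Counting

section Structure

open scoped Classical

variable {V : Type*}

theorem false_of_bowtie {G : SimpleGraph V} (hG : (book 3 1).Free G) {c x y z w : V}
    (hcx : G.Adj c x) (hcy : G.Adj c y) (hxy : G.Adj x y) (hcz : G.Adj c z) (hcw : G.Adj c w)
    (hzw : G.Adj z w) (h1 : x ≠ z) (h2 : x ≠ w) (h3 : y ≠ z) (h4 : y ≠ w) : False :=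
  hG (book_isContained_iff.2 ⟨c, x, y, z, w, hcx, hcy, hxy, hcz, hcw, hzw, h1, h2, h3, h4⟩)

/-- Two edges inside `P` would span a bowtie with common neighbours of their ends in `Q`. -/
theorem inner_edge_unique [Fintype V] {G : SimpleGraph V} (hG : (book 3 1).Free G)
    {P Q : Finset V} {m : ℕ} (h : ∀ x ∈ P, #{q ∈ Q | ¬ G.Adj x q} ≤ m) (hm : 4 * m + 2 ≤ #Q) {x y z w : V}
    (hx : x ∈ P) (hy : y ∈ P) (hz : z ∈ P) (hw : w ∈ P) (hxy : G.Adj x y) (hzw : G.Adj z w) :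
    x = z ∧ y = w ∨ x = w ∧ y = z := by
  have h1 := card_le_card_common_add G {x, y, z, w} Q m (by
    intro t ht
    simp only [mem_insert, mem_singleton] at ht
    rcases ht with rfl | rfl | rfl | rfl <;> exact h _ (by assumption))
  have h2 := Nat.mul_le_mul_right m (card_le_four (a := x) (b := y) (c := z) (d := w))
  obtain ⟨q, hq, q', hq', hqq⟩ := Finset.one_lt_card.1
    (show 1 < #{q ∈ Q | ∀ t ∈ ({x, y, z, w} : Finset V), G.Adj t q} by omega)
  simp only [mem_filter, mem_insert, mem_singleton, forall_eq_or_imp, forall_eq] at hq hq'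
  obtain ⟨-, qx, qy, qz, qw⟩ := hq
  obtain ⟨-, qx', qy', qz', qw'⟩ := hq'
  by_contra hne
  by_cases hxz : x = z
  · subst hxz
    exact false_of_bowtie hG hxy qx qy hzw qx' qw' (fun e => hne (Or.inl ⟨rfl, e⟩)) qy'.ne
      qw.ne' hqq
  by_cases hxw : x = w
  · subst hxw
    exact false_of_bowtie hG hxy qx qy hzw.symm qx' qz' (fun e => hne (Or.inr ⟨rfl, e⟩)) qy'.ne
      qz.ne' hqq
  by_cases hyz : y = z
  · subst hyz
    exact false_of_bowtie hG hxy.symm qy qx hzw qy' qw' hxw qx'.ne qw.ne' hqq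
  by_cases hyw : y = w
  · subst hyw
    exact false_of_bowtie hG hxy.symm qy qx hzw.symm qy' qz' hxz qx'.ne qz.ne' hqq
  exact false_of_bowtie hG qx.symm qy.symm hxy qz.symm qw.symm hzw hxz hxw hyz hyw

/-! ### Replacing the neighbourhood of a vertex -/

/-- `G` with the neighbourhood of `v` replaced by `Q` (without `v` itself). -/
def reattach (G : SimpleGraph V) (v : V) (Q : Finset V) : SimpleGraph V where
  Adj x y := x ≠ v ∧ y ≠ v ∧ G.Adj x y ∨ x = v ∧ y ∈ Q ∧ y ≠ v ∨ y = v ∧ x ∈ Q ∧ x ≠ v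
  symm := ⟨by
    rintro x y (⟨h1, h2, h3⟩ | h | h)
    · exact Or.inl ⟨h2, h1, h3.symm⟩
    · exact Or.inr (Or.inr h)
    · exact Or.inr (Or.inl h)⟩
  loopless := ⟨by
    rintro x (⟨-, -, h⟩ | ⟨h, -, h'⟩ | ⟨h, -, h'⟩)
    · exact G.loopless.irrefl x h
    · exact h' h
    · exact h' h⟩

/-- If the new neighbourhood is independent, then `v` lies in no triangle of the new graph. -/
theorem reattach_free {G : SimpleGraph V} (hG : (book 3 1).Free G) (v : V) {Q : Finset V}
    (hQ : ∀ x ∈ Q, ∀ y ∈ Q, ¬ G.Adj x y) : (book 3 1).Free (reattach G v Q) := by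
  have hv : ∀ x y, (reattach G v Q).Adj v x → (reattach G v Q).Adj v y →
      ¬ (reattach G v Q).Adj x y := by
    intro x y hx hy hxy
    simp only [reattach] at hx hy hxy
    have := hQ x
    grind
  have hG' : ∀ x y, (reattach G v Q).Adj x y → x ≠ v → y ≠ v → G.Adj x y := by
    intro x y h hx hy
    simp only [reattach] at h
    grind
  intro h
  obtain ⟨c, x, y, z, w, hcx, hcy, hxy, hcz, hcw, hzw, h1, h2, h3, h4⟩ :=
    book_isContained_iff.1 h
  have c1 : c ≠ v := by rintro rfl; exact hv _ _ hcx hcy hxy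
  have x1 : x ≠ v := by rintro rfl; exact hv _ _ hcx.symm hxy hcy
  have y1 : y ≠ v := by rintro rfl; exact hv _ _ hcy.symm hxy.symm hcx
  have z1 : z ≠ v := by rintro rfl; exact hv _ _ hcz.symm hzw hcw
  have w1 : w ≠ v := by rintro rfl; exact hv _ _ hcw.symm hzw.symm hcz
  exact false_of_bowtie hG (hG' _ _ hcx c1 x1) (hG' _ _ hcy c1 y1) (hG' _ _ hxy x1 y1)
    (hG' _ _ hcz c1 z1) (hG' _ _ hcw c1 w1) (hG' _ _ hzw z1 w1) h1 h2 h3 h4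

variable [Fintype V]

/-- `G` has the most copies of `K_{a,b}` among the bowtie-free graphs on its vertex set. -/
def IsExtremal (a b : ℕ) (G : SimpleGraph V) : Prop :=
  (book 3 1).Free G ∧ ∀ G' : SimpleGraph V, (book 3 1).Free G' →
    #(bicliques G' a b) ≤ #(bicliques G a b)

/-- In an extremal graph with an almost complete pair `(P, Q)`, `Q` independent, a vertex `v` with
few neighbours outside `Q` has few non-neighbours in `Q`: otherwise making `Q` the neighbourhood of
`v` would create more copies of `K_{a+1,b+1}` than it destroys. -/
theorem card_nonneighbors_mul_le {G : SimpleGraph V} {a b m : ℕ} (hG : IsExtremal (a + 1) (b + 1) G)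
    (v : V) {P Q : Finset V} (hQ : ∀ x ∈ Q, ∀ y ∈ Q, ¬ G.Adj x y)
    (hPQ : ∀ x ∈ P, #{q ∈ Q | ¬ G.Adj x q} ≤ m) (hQP : ∀ y ∈ Q, #{p ∈ P | ¬ G.Adj y p} ≤ m) :
    #{y ∈ Q | y ≠ v ∧ ¬ G.Adj v y} * ((#P - m - 1 - a) ^ a * (#Q - 2 - a * m - b) ^ b) ≤
      2 * ((a + 1) * (b + 1)) * #{w | G.Adj v w ∧ w ∉ Q} * Fintype.card V ^ (a + b) := by
  have hswap : #(bicliques (reattach G v Q) (a + 1) (b + 1) \ bicliques G (a + 1) (b + 1)) ≤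
      #(bicliques G (a + 1) (b + 1) \ bicliques (reattach G v Q) (a + 1) (b + 1)) :=
    card_sdiff_le_card_sdiff_iff.2 (hG.2 _ (reattach_free hG.1 v hQ))
  refine le_trans ?_ (hswap.trans ?_)
  · have hsub : ({y ∈ Q | y ≠ v ∧ ¬ G.Adj v y}).biUnion (fun y =>
        {f ∈ bicliques (reattach G v Q) (a + 1) (b + 1) | f.1 0 = v ∧ f.2 0 = y}) ⊆
        bicliques (reattach G v Q) (a + 1) (b + 1) \ bicliques G (a + 1) (b + 1) := by
      intro f hf
      obtain ⟨y, hy, hf⟩ := mem_biUnion.1 hf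
      obtain ⟨hf, hf1, hf2⟩ := mem_filter.1 hf
      refine mem_sdiff.2 ⟨hf, fun hf' => (mem_filter.1 hy).2.2 ?_⟩
      rw [← hf1, ← hf2]
      exact (mem_bicliques.1 hf').2.2 0 0
    refine le_trans ?_ (card_le_card hsub)
    rw [card_biUnion (by
      intro y _ y' _ hyy
      rw [Function.onFun, Finset.disjoint_left]
      intro f hf hf'
      exact hyy ((mem_filter.1 hf).2.2.symm.trans (mem_filter.1 hf').2.2)), ← smul_eq_mul,
      ← sum_const]
    refine sum_le_sum fun y hy => ?_
    obtain ⟨hyQ, hyv, -⟩ := mem_filter.1 hy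
    have key := le_card_bicliques_through (reattach G v Q) a b m (v := v) (y := y)
      (P := {p ∈ P | G.Adj y p}.erase v) (Q := (Q.erase v).erase y)
      (Or.inr (Or.inl ⟨rfl, hyQ, hyv⟩)) (by simp) (by simp)
      (by
        intro x hx
        simp only [mem_erase, mem_filter] at hx
        exact Or.inl ⟨hx.1, hyv, hx.2.2.symm⟩)
      (by
        intro q hq
        simp only [mem_erase] at hq
        exact Or.inr (Or.inl ⟨rfl, hq.2.2, hq.2.1⟩))
      (by
        intro x hx
        simp only [mem_erase, mem_filter] at hx
        refine (card_le_card ?_).trans (hPQ x hx.2.1)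
        intro q hq
        simp only [mem_erase, mem_filter] at hq ⊢
        exact ⟨hq.1.2.2, fun h => hq.2 (Or.inl ⟨hx.1, hq.1.2.1, h⟩)⟩)
    refine le_trans (Nat.mul_le_mul (Nat.pow_le_pow_left ?_ _) (Nat.pow_le_pow_left ?_ _)) key
    · have h1 := card_filter_add_card_filter_not (s := P) (fun p => G.Adj y p)
      have h2 := hQP y hyQ
      have h3 := pred_card_le_card_erase (s := {p ∈ P | G.Adj y p}) (a := v)
      omega
    · have h2 := pred_card_le_card_erase (s := Q) (a := v)
      have h3 := pred_card_le_card_erase (s := Q.erase v) (a := y)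
      omega
  · let E : Fin (a + 1) → Fin (b + 1) → V → V →
        Finset ((Fin (a + 1) → V) × (Fin (b + 1) → V)) :=
      fun i j x y => {f | f.1 i = x ∧ f.2 j = y}
    let D : Finset V := {w | G.Adj v w ∧ w ∉ Q}
    have hsub : bicliques G (a + 1) (b + 1) \ bicliques (reattach G v Q) (a + 1) (b + 1) ⊆
        ((univ : Finset (Fin (a + 1))) ×ˢ (univ : Finset (Fin (b + 1))) ×ˢ D).biUnion fun t =>
          E t.1 t.2.1 v t.2.2 ∪ E t.1 t.2.1 t.2.2 v := by
      intro f hf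
      obtain ⟨hf, hf'⟩ := mem_sdiff.1 hf
      obtain ⟨h1, h2, h3⟩ := mem_bicliques.1 hf
      have : ∃ i j, ¬ (reattach G v Q).Adj (f.1 i) (f.2 j) := by
        by_contra hcon
        push Not at hcon
        exact hf' (mem_bicliques.2 ⟨h1, h2, hcon⟩)
      obtain ⟨i, j, hij⟩ := this
      have hadj := h3 i j
      have hne := hadj.ne
      simp only [mem_biUnion, mem_product, mem_univ, true_and, mem_union, mem_filter, D, E]
      simp only [reattach, not_or, not_and] at hij
      by_cases hi : f.1 i = v
      · refine ⟨(i, j, f.2 j), ⟨hi ▸ hadj, fun hq => hij.2.1 hi hq ?_⟩, Or.inl ⟨hi, rfl⟩⟩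
        rw [← hi]; exact hne.symm
      · by_cases hj : f.2 j = v
        · exact ⟨(i, j, f.1 i), ⟨hj ▸ hadj.symm, fun hq => hij.2.2 hj hq hi⟩, Or.inr ⟨rfl, hj⟩⟩
        · exact (hij.1 hi hj hadj).elim
    refine (card_le_card hsub).trans ((card_biUnion_le_card_mul _ _
      (2 * Fintype.card V ^ (a + b)) ?_).trans (le_of_eq ?_))
    · rintro ⟨i, j, w⟩ -
      refine (card_union_le _ _).trans ?_
      have h1 := card_tuples_le a b i j v w
      have h2 := card_tuples_le a b i j w v
      exact (Nat.add_le_add h1 h2).trans (two_mul _).ge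
    · simp only [card_product, card_univ, Fintype.card_fin, D]
      ring

end Structure

section Exact

open scoped Classical

/-! ### Graphs with a good bipartition -/

variable {V : Type*}

/-- A graph with a single edge inside the classes of a bipartition is contained in the complete
bipartite graph with this edge added. -/
theorem exists_completeBipartitePlusEdge_ge {G : SimpleGraph V} {S : Finset V} {u v y : V}
    (hu : u ∈ S) (hv : v ∈ S) (huv : u ≠ v) (hy : y ∉ S)
    (h : ∀ x z, G.Adj x z → (x ∈ S ↔ z ∈ S) → x = u ∧ z = v ∨ x = v ∧ z = u) :
    ∃ T : SimpleGraph V, IsCompleteBipartitePlusEdge T ∧ G ≤ T := by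
  refine ⟨(⊤ : SimpleGraph V).between ↑S (↑S)ᶜ ⊔ SimpleGraph.edge u v,
    ⟨↑S, ⟨u, hu⟩, ⟨y, hy⟩, u, v, huv, ?_, rfl⟩, ?_⟩
  · simp [between_adj, hu, hv]
  · intro x z hxz
    have := hxz.ne
    have := h x z hxz
    simp only [sup_adj, between_adj, edge_adj, top_adj, Set.mem_compl_iff, mem_coe]
    tauto

theorem completeBipartitePlusEdge_free {T : SimpleGraph V} (hT : IsCompleteBipartitePlusEdge T) :
    (book 3 1).Free T := by
  obtain ⟨S, -, -, u, v, huv, hnadj, rfl⟩ := hT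
  -- every triangle contains the added edge, whose ends lie in the same part
  have hS : u ∈ S ↔ v ∈ S := by
    simp only [between_adj, top_adj, Set.mem_compl_iff] at hnadj
    tauto
  intro h
  obtain ⟨c, x, y, z, w, hcx, hcy, hxy, hcz, hcw, hzw, h1, h2, h3, h4⟩ :=
    book_isContained_iff.1 h
  have tri : ∀ p q r, ((⊤ : SimpleGraph V).between S Sᶜ ⊔ SimpleGraph.edge u v).Adj p q →
      ((⊤ : SimpleGraph V).between S Sᶜ ⊔ SimpleGraph.edge u v).Adj p r →
      ((⊤ : SimpleGraph V).between S Sᶜ ⊔ SimpleGraph.edge u v).Adj q r →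
      (u = p ∨ u = q ∨ u = r) ∧ (v = p ∨ v = q ∨ v = r) := by
    intro p q r hpq hpr hqr
    simp only [sup_adj, between_adj, edge_adj, top_adj, Set.mem_compl_iff] at hpq hpr hqr
    grind
  have t1 := tri _ _ _ hcx hcy hxy
  have t2 := tri _ _ _ hcz hcw hzw
  have := hcx.ne
  have := hcy.ne
  have := hcz.ne
  have := hcw.ne
  grind

variable [Fintype V]

/-- Suppose there is one edge `uv` inside `X` and one edge `yz` outside it, and each of `y`, `z` has a
non-neighbour in `X`. Then trading the edge `yz` for all missing edges across the bipartition does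
not decrease the number of copies of `K_{a,b}`. For `a = 1` no degree decreases. For `a ≥ 2` a copy
can use `yz` only if all its vertices are among `u, v, y, z`, so that boundedly many copies are
lost, while a single missing cross edge already gains more. -/
theorem card_bicliques_le_of_two_inner_edges {G T : SimpleGraph V} {a b : ℕ} (ha : 1 ≤ a)
    (hab : a ≤ b) {X : Finset V} {u v y z u₁ u₂ : V} (hy : y ∉ X) (hz : z ∉ X)
    (hyz : y ≠ z) (hX : ∀ x ∈ X, ∀ w ∈ X, G.Adj x w → x = u ∧ w = v ∨ x = v ∧ w = u)
    (hY : ∀ x ∉ X, ∀ w ∉ X, G.Adj x w → x = y ∧ w = z ∨ x = z ∧ w = y)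
    (hu₁ : u₁ ∈ X) (hyu : ¬ G.Adj y u₁) (hu₂ : u₂ ∈ X) (hzu : ¬ G.Adj z u₂)
    (hT : ∀ x ∈ X, ∀ w ∉ X, T.Adj x w)
    (hGT : ∀ x w, G.Adj x w → T.Adj x w ∨ x = y ∧ w = z ∨ x = z ∧ w = y)
    (hP : 4 ^ (a + b) + a + b ≤ #X) (hQ : 4 ^ (a + b) + a + b ≤ #Xᶜ) :
    #(bicliques G a b) ≤ #(bicliques T a b) := by
  rcases ha.eq_or_lt with rfl | ha2
  · rw [card_bicliques_one, card_bicliques_one]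
    refine sum_le_sum fun w _ => Nat.descFactorial_le _ ?_
    have hXle : ∀ t ∉ X, #X ≤ #{w | T.Adj t w} := fun t ht =>
      card_le_card fun x hx => mem_filter.2 ⟨mem_univ _, (hT x hx t ht).symm⟩
    have hend : ∀ s t r, s ∉ X → r ∈ X → ¬ G.Adj s r → (∀ w ∉ X, G.Adj s w → w = t) →
        #{w | G.Adj s w} ≤ #{w | T.Adj s w} := by
      intro s t r hs hr hsr hst
      refine le_trans ?_ (hXle s hs)
      have hsub : ({w | G.Adj s w} : Finset V) ⊆ insert t (X.erase r) := by
        intro w hw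
        have hw := (mem_filter.1 hw).2
        rw [mem_insert, mem_erase]
        by_cases hwX : w ∈ X
        · exact Or.inr ⟨fun e => hsr (e ▸ hw), hwX⟩
        · exact Or.inl (hst w hwX hw)
      refine (card_le_card hsub).trans ((card_insert_le _ _).trans ?_)
      rw [card_erase_of_mem hr]
      have := card_pos.2 ⟨r, hr⟩
      omega
    by_cases hwy : w = y
    · subst hwy
      refine hend w z u₁ hy hu₁ hyu fun t ht h => ?_
      rcases hY w hy t ht h with h | h
      · exact h.2
      · exact (hyz h.1).elim
    by_cases hwz : w = z
    · subst hwz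
      refine hend w y u₂ hz hu₂ hzu fun t ht h => ?_
      rcases hY w hz t ht h with h | h
      · exact (hwy h.1).elim
      · exact h.2
    refine card_le_card fun t ht => mem_filter.2 ⟨mem_univ _, ?_⟩
    rcases hGT w t (mem_filter.1 ht).2 with h | h | h
    · exact h
    · exact (hwy h.1).elim
    · exact (hwz h.1).elim
  · obtain ⟨a, rfl⟩ : ∃ a', a = a' + 2 := ⟨a - 2, by omega⟩
    obtain ⟨b, rfl⟩ : ∃ b', b = b' + 2 := ⟨b - 2, by omega⟩
    refine card_sdiff_le_card_sdiff_iff.1 ?_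
    have hlost : bicliques G (a + 2) (b + 2) \ bicliques T (a + 2) (b + 2) ⊆
        Fintype.piFinset (fun _ => {u, v, y, z}) ×ˢ Fintype.piFinset fun _ => {u, v, y, z} := by
      intro f hf
      obtain ⟨hf, hf'⟩ := mem_sdiff.1 hf
      obtain ⟨h1, h2, h3⟩ := mem_bicliques.1 hf
      have : ∃ i j, ¬ T.Adj (f.1 i) (f.2 j) := by
        by_contra hcon
        push Not at hcon
        exact hf' (mem_bicliques.2 ⟨h1, h2, hcon⟩)
      obtain ⟨i, j, hij⟩ := this
      have hij' : f.1 i = y ∧ f.2 j = z ∨ f.1 i = z ∧ f.2 j = y :=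
        (hGT _ _ (h3 i j)).resolve_left hij
      have hiX : f.1 i ∉ X := by rcases hij' with h | h <;> rw [h.1] <;> assumption
      have hjX : f.2 j ∉ X := by rcases hij' with h | h <;> rw [h.2] <;> assumption
      have hA : ∀ k, k ≠ i → f.1 k ∈ X := by
        intro k hk
        by_contra hkX
        have hk' : f.1 k ≠ f.1 i := fun e => hk (h1 e)
        have := hY _ hkX _ hjX (h3 k j)
        grind
      have hB : ∀ k, k ≠ j → f.2 k ∈ X := by
        intro k hk
        by_contra hkX
        have hk' : f.2 k ≠ f.2 j := fun e => hk (h2 e)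
        have := hY _ hiX _ hkX (h3 i k)
        grind
      obtain ⟨i', hi'⟩ := exists_ne i
      obtain ⟨j', hj'⟩ := exists_ne j
      refine mem_product.2 ⟨Fintype.mem_piFinset.2 fun k => ?_, Fintype.mem_piFinset.2 fun k => ?_⟩
      · by_cases hk : k = i
        · subst hk
          rcases hij' with h | h <;> simp [h.1]
        · rcases hX _ (hA k hk) _ (hB j' hj') (h3 k j') with h | h <;> simp [h.1]
      · by_cases hk : k = j
        · subst hk
          rcases hij' with h | h <;> simp [h.2]
        · rcases hX _ (hA i' hi') _ (hB k hk) (h3 i' k) with h | h <;> simp [h.2]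
    have hgain : ({f ∈ bicliques T (a + 2) (b + 2) | f.1 0 = u₁ ∧ f.2 0 = y} : Finset _) ⊆
        bicliques T (a + 2) (b + 2) \ bicliques G (a + 2) (b + 2) := by
      intro f hf
      obtain ⟨hf, hf1, hf2⟩ := mem_filter.1 hf
      refine mem_sdiff.2 ⟨hf, fun hf' => hyu ?_⟩
      rw [← hf1, ← hf2]
      exact ((mem_bicliques.1 hf').2.2 0 0).symm
    have hrich := le_card_bicliques_through T (a + 1) (b + 1) 0 (v := u₁) (y := y)
      (P := X.erase u₁) (Q := Xᶜ.erase y) (hT _ hu₁ _ hy) (by simp) (by simp)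
      (fun x hx => hT _ (mem_of_mem_erase hx) _ hy)
      (fun q hq => hT _ hu₁ _ (mem_compl.1 (mem_of_mem_erase hq)))
      (by
        intro x hx
        rw [Nat.le_zero, card_eq_zero, filter_eq_empty_iff]
        intro q hq h
        exact h (hT _ (mem_of_mem_erase hx) _ (mem_compl.1 (mem_of_mem_erase hq))))
    refine (card_le_card hlost).trans (le_trans ?_ (hrich.trans (card_le_card hgain)))
    rw [card_product, Fintype.card_piFinset, Fintype.card_piFinset, prod_const, prod_const,
      card_univ, card_univ, Fintype.card_fin, Fintype.card_fin, ← pow_add]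
    have h4 : #({u, v, y, z} : Finset V) ≤ 4 := card_le_four
    refine (Nat.pow_le_pow_left h4 _).trans ?_
    have e1 := card_erase_of_mem hu₁
    have e2 := card_erase_of_mem (mem_compl.2 hy)
    calc 4 ^ (a + 2 + (b + 2)) ≤ #(X.erase u₁) - (a + 1) := by omega
      _ ≤ (#(X.erase u₁) - (a + 1)) ^ (a + 1) := Nat.le_self_pow (by omega) _
      _ = (#(X.erase u₁) - (a + 1)) ^ (a + 1) * 1 := (mul_one _).symm
      _ ≤ _ := Nat.mul_le_mul_left _ (Nat.one_le_pow _ _ (by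
        have := Nat.one_le_pow (a + 2 + (b + 2)) 4 (by norm_num)
        omega))

/-- A bowtie-free graph with a bipartition all of whose vertices are joined to almost all of a large
set on the other side has at most as many copies of `K_{a,b}` as some complete bipartite graph with
one additional edge. -/
theorem exists_card_bicliques_le {G : SimpleGraph V} (hG : (book 3 1).Free G) {a b m : ℕ}
    (ha : 1 ≤ a) (hab : a ≤ b) {X P Q : Finset V} (hPX : P ⊆ X) (hQX : Q ⊆ Xᶜ)
    (hX : ∀ x ∈ X, #{q ∈ Q | ¬ G.Adj x q} ≤ m) (hY : ∀ y ∉ X, #{p ∈ P | ¬ G.Adj y p} ≤ m)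
    (hP : 4 * m + 4 ^ (a + b) + a + b + 4 ≤ #P) (hQ : 4 * m + 4 ^ (a + b) + a + b + 4 ≤ #Q) :
    ∃ T : SimpleGraph V, IsCompleteBipartitePlusEdge T ∧
      #(bicliques G a b) ≤ #(bicliques T a b) := by
  have h4 : 0 < 4 ^ (a + b) := by positivity
  have hPc := card_le_card hPX
  have hQc := card_le_card hQX
  suffices h : ∀ S : Finset V, 2 ≤ #S → 1 ≤ #Sᶜ →
      (∀ x ∈ S, ∀ y ∈ S, ∀ z ∈ S, ∀ w ∈ S, G.Adj x y → G.Adj z w →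
        x = z ∧ y = w ∨ x = w ∧ y = z) → (∀ x ∉ S, ∀ y ∉ S, ¬ G.Adj x y) →
      ∃ T : SimpleGraph V, IsCompleteBipartitePlusEdge T ∧ G ≤ T by
    have hX1 : ∀ x ∈ X, ∀ y ∈ X, ∀ z ∈ X, ∀ w ∈ X, G.Adj x y → G.Adj z w →
        x = z ∧ y = w ∨ x = w ∧ y = z := fun x hx y hy z hz w hw h1 h2 =>
      inner_edge_unique hG hX (by omega) hx hy hz hw h1 h2
    have hY1 : ∀ x ∈ Xᶜ, ∀ y ∈ Xᶜ, ∀ z ∈ Xᶜ, ∀ w ∈ Xᶜ, G.Adj x y → G.Adj z w →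
        x = z ∧ y = w ∨ x = w ∧ y = z := fun x hx y hy z hz w hw h1 h2 =>
      inner_edge_unique hG (fun x hx => hY x (mem_compl.1 hx)) (by omega) hx hy hz hw h1 h2
    by_cases hY0 : ∀ x ∉ X, ∀ y ∉ X, ¬ G.Adj x y
    · obtain ⟨T, hT, hle⟩ := h X (by omega) (by omega) hX1 hY0
      exact ⟨T, hT, card_le_card (bicliques_mono hle a b)⟩
    by_cases hX0 : ∀ x ∈ X, ∀ y ∈ X, ¬ G.Adj x y
    · obtain ⟨T, hT, hle⟩ := h Xᶜ (by omega) (by rw [compl_compl]; omega) hY1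
        (fun x hx y hy => hX0 x (by simpa using hx) y (by simpa using hy))
      exact ⟨T, hT, card_le_card (bicliques_mono hle a b)⟩
    push Not at hY0 hX0
    obtain ⟨y, hy, z, hz, hyz⟩ := hY0
    obtain ⟨u, hu, v, hv, huv⟩ := hX0
    have hmiss : ∀ y z, y ∉ X → z ∉ X → G.Adj y z → ∃ t ∈ X, ¬ G.Adj y t := by
      intro y z hy hz hyz
      by_contra! hall
      have h1 := card_le_card_common_add G {y, z} P m (by
        intro t ht
        simp only [mem_insert, mem_singleton] at ht
        rcases ht with rfl | rfl <;> exact hY _ (by assumption))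
      have h2 := Nat.mul_le_mul_right m (card_le_two (a := y) (b := z))
      obtain ⟨p, hp, hpuv⟩ := exists_mem_notMem_of_card_lt_card (s := {u, v})
        (t := {q ∈ P | ∀ t ∈ ({y, z} : Finset V), G.Adj t q})
        (lt_of_le_of_lt (card_le_two (a := u) (b := v)) (by omega))
      simp only [mem_filter, mem_insert, mem_singleton, forall_eq_or_imp, forall_eq] at hp
      simp only [mem_insert, mem_singleton, not_or] at hpuv
      exact false_of_bowtie hG (hall u hu) (hall v hv) huv hyz hp.2.1 hp.2.2
        (fun e => hz (e ▸ hu)) (Ne.symm hpuv.1) (fun e => hz (e ▸ hv)) (Ne.symm hpuv.2)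
    obtain ⟨u₁, hu₁, hyu⟩ := hmiss y z hy hz hyz
    obtain ⟨u₂, hu₂, hzu⟩ := hmiss z y hz hy hyz.symm
    refine ⟨(⊤ : SimpleGraph V).between ↑X (↑X)ᶜ ⊔ SimpleGraph.edge u v,
      ⟨↑X, ⟨u, hu⟩, ⟨y, hy⟩, u, v, huv.ne, by simp [between_adj, hu, hv], rfl⟩, ?_⟩
    have hX2 : ∀ x ∈ X, ∀ w ∈ X, G.Adj x w → x = u ∧ w = v ∨ x = v ∧ w = u :=
      fun x hx w hw h => hX1 x hx w hw u hu v hv h huv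
    have hY2 : ∀ x ∉ X, ∀ w ∉ X, G.Adj x w → x = y ∧ w = z ∨ x = z ∧ w = y :=
      fun x hx w hw h => hY1 x (mem_compl.2 hx) w (mem_compl.2 hw) y (mem_compl.2 hy) z
        (mem_compl.2 hz) h hyz
    refine card_bicliques_le_of_two_inner_edges ha hab hy hz hyz.ne hX2 hY2 hu₁ hyu hu₂ hzu ?_ ?_
      (by omega) (by omega)
    · intro x hx w hw
      refine Or.inl ⟨?_, Or.inl ⟨hx, hw⟩⟩
      rintro rfl
      exact hw hx
    · intro x w hxw
      by_cases hx : x ∈ X <;> by_cases hw : w ∈ X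
      · exact Or.inl (Or.inr ((edge_adj ..).2 ⟨hX2 x hx w hw hxw, hxw.ne⟩))
      · exact Or.inl (Or.inl ⟨hxw.ne, Or.inl ⟨hx, hw⟩⟩)
      · exact Or.inl (Or.inl ⟨hxw.ne, Or.inr ⟨hx, hw⟩⟩)
      · exact Or.inr (hY2 x hx w hw hxw)
  intro S hS hSc h1 h2
  obtain ⟨y, hy⟩ := card_pos.1 hSc
  by_cases hne : ∃ u ∈ S, ∃ v ∈ S, G.Adj u v
  · obtain ⟨u, hu, v, hv, huv⟩ := hne
    refine exists_completeBipartitePlusEdge_ge hu hv huv.ne (mem_compl.1 hy) ?_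
    intro x z hxz hiff
    by_cases hx : x ∈ S
    · exact h1 x hx z (hiff.1 hx) u hu v hv hxz huv
    · exact (h2 x hx z (fun h => hx (hiff.2 h)) hxz).elim
  · push Not at hne
    obtain ⟨u, hu, v, hv, huv⟩ := one_lt_card.1 (show 1 < #S by omega)
    refine exists_completeBipartitePlusEdge_ge hu hv huv (mem_compl.1 hy) ?_
    intro x z hxz hiff
    by_cases hx : x ∈ S
    · exact (hne x hx z (hiff.1 hx) hxz).elim
    · exact (h2 x hx z (fun h => hx (hiff.2 h)) hxz).elim

end Exact

section Majorization

open scoped Classical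

variable {V : Type*} [Fintype V]

/-! ### Majorization by a complete bipartite graph -/

/-- Pairs of tuples, from `X` and from `Z`, that are completely joined; the entries of a tuple may
coincide. -/
noncomputable def homTuples (G : SimpleGraph V) (X Z : Finset V) (a b : ℕ) :
    Finset ((Fin a → V) × (Fin b → V)) :=
  {f | (∀ i, f.1 i ∈ X) ∧ (∀ j, f.2 j ∈ Z) ∧ ∀ i j, G.Adj (f.1 i) (f.2 j)}

theorem mem_homTuples {G : SimpleGraph V} {X Z : Finset V} {a b : ℕ}
    {f : (Fin a → V) × (Fin b → V)} : f ∈ homTuples G X Z a b ↔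
      (∀ i, f.1 i ∈ X) ∧ (∀ j, f.2 j ∈ Z) ∧ ∀ i j, G.Adj (f.1 i) (f.2 j) := by
  simp [homTuples]

theorem card_homTuples (G : SimpleGraph V) (X Z : Finset V) (a b : ℕ) :
    #(homTuples G X Z a b) =
      ∑ A ∈ Fintype.piFinset fun _ : Fin a => X, #{y ∈ Z | ∀ i, G.Adj (A i) y} ^ b := by
  rw [card_eq_sum_card_fiberwise (f := fun f => f.1) (t := Fintype.piFinset fun _ : Fin a => X)
    (fun f hf => by
      have := (mem_homTuples.1 hf).1
      simpa using this)]
  refine sum_congr rfl fun A hA => ?_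
  have h : #{y ∈ Z | ∀ i, G.Adj (A i) y} ^ b =
      #(Fintype.piFinset fun _ : Fin b => ({y ∈ Z | ∀ i, G.Adj (A i) y} : Finset V)) := by
    rw [Fintype.card_piFinset, prod_const, card_univ, Fintype.card_fin]
  rw [h]
  refine card_bij (fun f _ => f.2) ?_ ?_ ?_
  · intro f hf
    have h1 := mem_homTuples.1 (mem_filter.1 hf).1
    have h2 : f.1 = A := (mem_filter.1 hf).2
    rw [Fintype.mem_piFinset]
    exact fun j => mem_filter.2 ⟨h1.2.1 j, fun i => h2 ▸ h1.2.2 i j⟩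
  · intro f hf g hg h
    exact Prod.ext ((mem_filter.1 hf).2.trans (mem_filter.1 hg).2.symm) h
  · intro B hB
    have hB' : ∀ j, B j ∈ Z ∧ ∀ i, G.Adj (A i) (B j) := fun j =>
      mem_filter.1 (Fintype.mem_piFinset.1 hB j)
    exact ⟨(A, B), mem_filter.2 ⟨mem_homTuples.2 ⟨Fintype.mem_piFinset.1 hA, fun j => (hB' j).1,
      fun i j => (hB' j).2 i⟩, rfl⟩, rfl⟩

theorem card_homTuples_comm (G : SimpleGraph V) (X Z : Finset V) (a b : ℕ) :
    #(homTuples G X Z a b) = #(homTuples G Z X b a) := by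
  refine card_bij (fun f _ => f.swap) ?_ ?_ ?_
  · intro f hf
    obtain ⟨h1, h2, h3⟩ := mem_homTuples.1 hf
    exact mem_homTuples.2 ⟨h2, h1, fun i j => (h3 j i).symm⟩
  · intro f _ g _ h
    exact Prod.swap_injective h
  · intro f hf
    obtain ⟨h1, h2, h3⟩ := mem_homTuples.1 hf
    exact ⟨f.swap, mem_homTuples.2 ⟨h2, h1, fun i j => (h3 j i).symm⟩, rfl⟩

/-- If the complement of `X` is independent, then each copy of `K_{a+1,b+1}` has one of its two sides
inside `X`. Hence the copies are at most as many as in a complete bipartite graph with parts of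
sizes `|X|` and `Δ`, and the bound is not attained if many vertices of `X` have degree less than `Δ`
or if `X` contains many copies. -/
theorem card_bicliques_add_card_homTuples_le (G : SimpleGraph V) (a b : ℕ) {X : Finset V} {Δ : ℕ}
    (hX : ∀ x ∉ X, ∀ y ∉ X, ¬ G.Adj x y) (hΔ : ∀ v, #{w | G.Adj v w} ≤ Δ) :
    #(bicliques G (a + 1) (b + 1)) + #(homTuples G X X (a + 1) (b + 1)) ≤
      #X ^ a * Δ ^ b * ∑ x ∈ X, #{w | G.Adj x w} + #X ^ (b + 1) * Δ ^ (a + 1) := by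
  have hsub : bicliques G (a + 1) (b + 1) ⊆
      homTuples G X univ (a + 1) (b + 1) ∪ homTuples G univ X (a + 1) (b + 1) := by
    intro f hf
    obtain ⟨-, -, h⟩ := mem_bicliques.1 hf
    rw [mem_union, mem_homTuples, mem_homTuples]
    by_contra hcon
    have h1 : ∃ i, f.1 i ∉ X := by
      by_contra! hall
      exact hcon (Or.inl ⟨hall, by simp, h⟩)
    have h2 : ∃ j, f.2 j ∉ X := by
      by_contra! hall
      exact hcon (Or.inr ⟨by simp, hall, h⟩)
    obtain ⟨i, hi⟩ := h1
    obtain ⟨j, hj⟩ := h2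
    exact hX _ hi _ hj (h i j)
  have hinter : homTuples G X univ (a + 1) (b + 1) ∩ homTuples G univ X (a + 1) (b + 1) =
      homTuples G X X (a + 1) (b + 1) := by
    ext f
    simp only [mem_inter, mem_homTuples, mem_univ]
    tauto
  have h1 : #(homTuples G X univ (a + 1) (b + 1)) ≤
      #X ^ a * Δ ^ b * ∑ x ∈ X, #{w | G.Adj x w} := by
    rw [card_homTuples]
    calc _ ≤ ∑ A ∈ Fintype.piFinset fun _ : Fin (a + 1) => X, Δ ^ b * #{w | G.Adj (A 0) w} := by
          refine sum_le_sum fun A _ => ?_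
          have : #{y | ∀ i, G.Adj (A i) y} ≤ #{w | G.Adj (A 0) w} :=
            card_le_card fun y hy => mem_filter.2 ⟨mem_univ _, (mem_filter.1 hy).2 0⟩
          rw [pow_succ]
          exact Nat.mul_le_mul (Nat.pow_le_pow_left (this.trans (hΔ _)) _) this
      _ = _ := by
          rw [Fintype.sum_piFinset_apply (fun x => Δ ^ b * #{w | G.Adj x w}) X 0, ← mul_sum]
          simp [mul_assoc]
  have h2 : #(homTuples G univ X (a + 1) (b + 1)) ≤ #X ^ (b + 1) * Δ ^ (a + 1) := by
    rw [card_homTuples_comm, card_homTuples]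
    calc _ ≤ ∑ A ∈ Fintype.piFinset fun _ : Fin (b + 1) => X, Δ ^ (a + 1) := by
          refine sum_le_sum fun A _ => Nat.pow_le_pow_left ?_ _
          have : #{y | ∀ i, G.Adj (A i) y} ≤ #{w | G.Adj (A 0) w} :=
            card_le_card fun y hy => mem_filter.2 ⟨mem_univ _, (mem_filter.1 hy).2 0⟩
          exact this.trans (hΔ (A 0))
      _ = _ := by simp
  have h3 := card_union_add_card_inter (homTuples G X univ (a + 1) (b + 1))
    (homTuples G univ X (a + 1) (b + 1))
  rw [hinter] at h3
  have h4 := card_le_card hsub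
  omega

/-- Supersaturation, by two applications of Jensen's inequality: many edges inside `X` force many
completely joined pairs of tuples. -/
theorem sum_degree_pow_le (G : SimpleGraph V) (a b : ℕ) (X : Finset V) :
    (∑ x ∈ X, #{w ∈ X | G.Adj x w}) ^ ((a + 1) * (b + 1)) ≤
      #X ^ (a * (b + 1) + (a + 1) * b) * #(homTuples G X X (a + 1) (b + 1)) := by
  have h1 := pow_sum_le_card_mul_sum_pow (s := X) (f := fun x => #{w ∈ X | G.Adj x w})
    (fun _ _ => Nat.zero_le _) a
  have h2 := pow_sum_le_card_mul_sum_pow (s := Fintype.piFinset fun _ : Fin (a + 1) => X)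
    (f := fun A => #{y ∈ X | ∀ i, G.Adj (A i) y}) (fun _ _ => Nat.zero_le _) b
  have h3 : ∑ A ∈ Fintype.piFinset fun _ : Fin (a + 1) => X, #{y ∈ X | ∀ i, G.Adj (A i) y} =
      ∑ x ∈ X, #{w ∈ X | G.Adj x w} ^ (a + 1) := by
    have e1 := card_homTuples G X X (a + 1) 1
    rw [card_homTuples_comm, card_homTuples] at e1
    have e2 := Fintype.sum_piFinset_apply (fun x => #{w ∈ X | G.Adj x w} ^ (a + 1)) X (0 : Fin 1)
    simp only [Fintype.card_fin, tsub_self, pow_zero, one_smul] at e2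
    rw [← e2]
    simp only [pow_one] at e1
    rw [← e1]
    refine sum_congr rfl fun A _ => ?_
    simp
  rw [← card_homTuples, h3, Fintype.card_piFinset, prod_const, card_univ, Fintype.card_fin] at h2
  calc _ = ((∑ x ∈ X, #{w ∈ X | G.Adj x w}) ^ (a + 1)) ^ (b + 1) := by rw [pow_mul]
    _ ≤ (#X ^ a * ∑ x ∈ X, #{w ∈ X | G.Adj x w} ^ (a + 1)) ^ (b + 1) := Nat.pow_le_pow_left h1 _
    _ = #X ^ (a * (b + 1)) * (∑ x ∈ X, #{w ∈ X | G.Adj x w} ^ (a + 1)) ^ (b + 1) := by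
      rw [mul_pow, ← pow_mul]
    _ ≤ #X ^ (a * (b + 1)) * ((#X ^ (a + 1)) ^ b * #(homTuples G X X (a + 1) (b + 1))) :=
      Nat.mul_le_mul_left _ h2
    _ = _ := by rw [← pow_mul, ← mul_assoc, ← pow_add]

/-- In a bowtie-free graph, the edges inside a neighbourhood are pairwise intersecting, so deleting
the ends of one of them leaves an independent set `Y`. Here `Δ` is the maximum degree, and `Y` comes
from the neighbourhood of a vertex attaining it. -/
theorem exists_independent [Nonempty V] {G : SimpleGraph V} (hG : (book 3 1).Free G) :
    ∃ (Y : Finset V) (Δ : ℕ), (∀ x ∈ Y, ∀ y ∈ Y, ¬ G.Adj x y) ∧ #Y ≤ Δ ∧ Δ ≤ #Y + 2 ∧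
      Δ ≤ Fintype.card V ∧ ∀ v, #{w | G.Adj v w} ≤ Δ := by
  obtain ⟨u, -, hu⟩ := exists_max_image univ (fun v => #{w | G.Adj v w}) univ_nonempty
  by_cases h : ∃ x y, G.Adj u x ∧ G.Adj u y ∧ G.Adj x y
  · obtain ⟨x, y, hx, hy, hxy⟩ := h
    refine ⟨(({w | G.Adj u w} : Finset V).erase x).erase y, #{w | G.Adj u w}, ?_, ?_, ?_,
      card_le_univ _, fun v => hu v (mem_univ v)⟩
    · intro z hz w hw hzw
      simp only [mem_erase, mem_filter, mem_univ, true_and] at hz hw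
      exact false_of_bowtie hG hx hy hxy hz.2.2 hw.2.2 hzw (Ne.symm hz.2.1) (Ne.symm hw.2.1)
        (Ne.symm hz.1) (Ne.symm hw.1)
    · exact card_le_card ((erase_subset _ _).trans (erase_subset _ _))
    · have h1 := pred_card_le_card_erase (s := ({w | G.Adj u w} : Finset V)) (a := x)
      have h2 := pred_card_le_card_erase (s := ({w | G.Adj u w} : Finset V).erase x) (a := y)
      omega
  · refine ⟨({w | G.Adj u w} : Finset V), #{w | G.Adj u w}, ?_, le_rfl, by omega,
      card_le_univ _, fun v => hu v (mem_univ v)⟩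
    intro x hx y hy hxy
    exact h ⟨x, y, (mem_filter.1 hx).2, (mem_filter.1 hy).2, hxy⟩

/-- Extremality is used against the complete bipartite graph with parts `S` and `Sᶜ`. -/
theorem IsExtremal.le_card_bicliques {G : SimpleGraph V} {a b : ℕ} (hG : IsExtremal a b G)
    (ha : 1 ≤ a) (S : Finset V) :
    (#S).descFactorial a * (#Sᶜ).descFactorial b + (#S).descFactorial b * (#Sᶜ).descFactorial a ≤
      #(bicliques G a b) := by
  refine (le_card_bicliques_of_complete ((⊤ : SimpleGraph V).between ↑S (↑S)ᶜ) ha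
    disjoint_compl_right ?_).trans (hG.2 _ ?_)
  · intro x hx y hy
    refine ⟨?_, Or.inl ⟨hx, mem_compl.1 hy⟩⟩
    rintro rfl
    exact mem_compl.1 hy hx
  · intro h
    obtain ⟨c, x, y, -, -, hcx, hcy, hxy, -⟩ := book_isContained_iff.1 h
    simp only [between_adj, Set.mem_compl_iff] at hcx hcy hxy
    tauto

end Majorization

section Stability

open scoped Classical

/-! ### Stability -/

theorem mul_pow_sub_pow_le {n M x y : ℝ} (hy : 0 ≤ y) (hyx : y ≤ x) (hxn : x ≤ n)
    (hM : x - y ≤ M) (s : ℕ) : n * (x ^ s - y ^ s) ≤ s * M * n ^ s := by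
  have hx : 0 ≤ x := hy.trans hyx
  have hn : 0 ≤ n := hx.trans hxn
  have hM0 : 0 ≤ M := (sub_nonneg.2 hyx).trans hM
  induction s with
  | zero => simp
  | succ s ih =>
    have h1 : x ^ s * (x - y) ≤ n ^ s * M :=
      mul_le_mul (pow_le_pow_left₀ hx hxn s) hM (sub_nonneg.2 hyx) (by positivity)
    have h2 : y * (n * (x ^ s - y ^ s)) ≤ n * (s * M * n ^ s) :=
      (mul_le_mul_of_nonneg_left ih hy).trans
        (mul_le_mul_of_nonneg_right (hyx.trans hxn) (by positivity))
    push_cast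
    calc n * (x ^ (s + 1) - y ^ (s + 1))
        = n * (x ^ s * (x - y)) + y * (n * (x ^ s - y ^ s)) := by ring
      _ ≤ n * (n ^ s * M) + n * (s * M * n ^ s) :=
        add_le_add (mul_le_mul_of_nonneg_left h1 hn) h2
      _ = (s + 1) * M * n ^ (s + 1) := by ring

theorem mul_pow_mul_pow_sub_le {n M x y x' y' : ℝ} (hy : 0 ≤ y) (hyx : y ≤ x) (hxn : x ≤ n)
    (hM : x - y ≤ M) (hy' : 0 ≤ y') (hyx' : y' ≤ x') (hxn' : x' ≤ n) (hM' : x' - y' ≤ M)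
    (s t : ℕ) : n * (x ^ s * x' ^ t - y ^ s * y' ^ t) ≤ (s + t) * M * n ^ (s + t) := by
  have hx : 0 ≤ x := hy.trans hyx
  have hx' : 0 ≤ x' := hy'.trans hyx'
  have hn : 0 ≤ n := hx.trans hxn
  have hM0 : 0 ≤ M := (sub_nonneg.2 hyx).trans hM
  have h1 := mul_pow_sub_pow_le hy hyx hxn hM s
  have h2 := mul_pow_sub_pow_le hy' hyx' hxn' hM' t
  have hs : 0 ≤ n * (x ^ s - y ^ s) :=
    mul_nonneg hn (sub_nonneg.2 (pow_le_pow_left₀ hy hyx s))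
  calc n * (x ^ s * x' ^ t - y ^ s * y' ^ t)
      = n * (x ^ s - y ^ s) * x' ^ t + y ^ s * (n * (x' ^ t - y' ^ t)) := by ring
    _ ≤ s * M * n ^ s * n ^ t + n ^ s * (t * M * n ^ t) :=
      add_le_add (mul_le_mul h1 (pow_le_pow_left₀ hx' hxn' t) (by positivity) (by positivity))
        (mul_le_mul (pow_le_pow_left₀ hy (hyx.trans hxn) s) h2
          (mul_nonneg hn (sub_nonneg.2 (pow_le_pow_left₀ hy' hyx' t))) (by positivity))
    _ = (s + t) * M * n ^ (s + t) := by ring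

theorem pow_sub_le_descFactorial_real (x a : ℕ) :
    ((x - a : ℕ) : ℝ) ^ (a + 1) ≤ (x.descFactorial (a + 1) : ℝ) := by
  have := Nat.pow_sub_le_descFactorial x (a + 1)
  rw [Nat.add_sub_add_right] at this
  exact_mod_cast this

/-- A balanced complete bipartite graph shows that an extremal graph has order `n ^ (a + b + 2)`
copies of `K_{a+1,b+1}`. -/
theorem IsExtremal.card_div_four_pow_le {V : Type*} [Fintype V] {G : SimpleGraph V} {a b : ℕ}
    (hG : IsExtremal (a + 1) (b + 1) G) (hn : 4 * (a + b + 1) ≤ Fintype.card V) :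
    ((Fintype.card V : ℝ) / 4) ^ (a + b + 2) ≤ #(bicliques G (a + 1) (b + 1)) := by
  obtain ⟨S, -, hS⟩ := exists_subset_card_eq (s := (univ : Finset V)) (n := Fintype.card V / 2)
    (by rw [card_univ]; omega)
  have hSc : #Sᶜ = Fintype.card V - Fintype.card V / 2 := by rw [card_compl, hS]
  have h1 := hG.le_card_bicliques (by omega) S
  have h2 := pow_sub_le_descFactorial_real #S a
  have h3 := pow_sub_le_descFactorial_real #Sᶜ b
  have h4 : (Fintype.card V : ℝ) / 4 ≤ ((#S - a : ℕ) : ℝ) := by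
    rw [div_le_iff₀ (by norm_num)]
    exact_mod_cast (show Fintype.card V ≤ (#S - a) * 4 by omega)
  have h5 : (Fintype.card V : ℝ) / 4 ≤ ((#Sᶜ - b : ℕ) : ℝ) := by
    rw [div_le_iff₀ (by norm_num)]
    exact_mod_cast (show Fintype.card V ≤ (#Sᶜ - b) * 4 by omega)
  have h0 : 0 ≤ (Fintype.card V : ℝ) / 4 := by positivity
  calc ((Fintype.card V : ℝ) / 4) ^ (a + b + 2)
      = ((Fintype.card V : ℝ) / 4) ^ (a + 1) * ((Fintype.card V : ℝ) / 4) ^ (b + 1) := by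
        rw [← pow_add]; congr 1; omega
    _ ≤ ((#S).descFactorial (a + 1) : ℝ) * ((#Sᶜ).descFactorial (b + 1) : ℝ) :=
      mul_le_mul ((pow_le_pow_left₀ h0 h4 _).trans h2) ((pow_le_pow_left₀ h0 h5 _).trans h3)
        (by positivity) (by positivity)
    _ ≤ _ := by exact_mod_cast (Nat.le_add_right _ _).trans h1

theorem le_mul_of_pow_mul_pow_mul_le {c n x y d K : ℝ} {a b : ℕ} (hc : 0 < c) (hn : 0 < n)
    (hx : c * n ≤ x) (hy : c * n ≤ y) (hd : 0 ≤ d)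
    (h : x ^ a * y ^ b * d ≤ K * n ^ (a + b + 1)) : d ≤ K / c ^ (a + b) * n := by
  have hcn : 0 ≤ c * n := by positivity
  have h1 : c ^ (a + b) * n ^ (a + b) ≤ x ^ a * y ^ b := by
    rw [← mul_pow, pow_add]
    exact mul_le_mul (pow_le_pow_left₀ hcn hx _) (pow_le_pow_left₀ hcn hy _) (by positivity)
      (pow_nonneg (hcn.trans hx) _)
  have h2 := mul_le_mul_of_nonneg_right h1 hd
  rw [div_mul_eq_mul_div, le_div_iff₀ (by positivity)]
  refine le_of_mul_le_mul_right (a := n ^ (a + b)) ?_ (by positivity)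
  calc d * c ^ (a + b) * n ^ (a + b) = c ^ (a + b) * n ^ (a + b) * d := by ring
    _ ≤ K * n ^ (a + b + 1) := h2.trans h
    _ = K * n * n ^ (a + b) := by ring

theorem le_mul_sq_of_pow_le {ε n D H K p : ℝ} {a b : ℕ} (hε : 0 < ε) (hn : 0 < n) (hp : 0 ≤ p)
    (hpn : p ≤ n) (hK : 0 ≤ K) (hH : H ≤ K * n ^ (a + b + 1))
    (hD : D ^ ((a + 1) * (b + 1)) ≤ p ^ (a * (b + 1) + (a + 1) * b) * H)
    (hKn : K / ε ^ ((a + 1) * (b + 1)) < n) : D ≤ ε * n ^ 2 := by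
  by_contra! hcon
  have h1 : (ε * n ^ 2) ^ ((a + 1) * (b + 1)) ≤
      n ^ (a * (b + 1) + (a + 1) * b) * (K * n ^ (a + b + 1)) :=
    (pow_le_pow_left₀ (by positivity) hcon.le _).trans (hD.trans
      ((mul_le_mul_of_nonneg_left hH (by positivity)).trans
        (mul_le_mul_of_nonneg_right (pow_le_pow_left₀ hp hpn _) (by positivity))))
  have hexp : 2 * ((a + 1) * (b + 1)) = 1 + (a * (b + 1) + (a + 1) * b + (a + b + 1)) := by ring
  have h2 : (ε ^ ((a + 1) * (b + 1)) * n) * n ^ (a * (b + 1) + (a + 1) * b + (a + b + 1)) ≤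
      K * n ^ (a * (b + 1) + (a + 1) * b + (a + b + 1)) := by
    calc _ = (ε * n ^ 2) ^ ((a + 1) * (b + 1)) := by
          rw [mul_pow, ← pow_mul, hexp, pow_add n 1, pow_one, mul_assoc]
      _ ≤ _ := h1
      _ = _ := by rw [pow_add _ _ (a + b + 1), mul_left_comm]
  have h3 := le_of_mul_le_mul_right h2 (by positivity)
  rw [div_lt_iff₀ (by positivity)] at hKn
  linarith

/-- Comparison of the upper bound for the number `L` of copies with the lower bound from the complete
bipartite graph with parts of sizes `p` and `q`, where `q` differs from `Δ` by at most two. -/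
theorem loss_le {a b p q Δ n : ℕ} {L H S : ℝ} (hpn : p ≤ n) (hΔn : Δ ≤ n) (hqΔ : q ≤ Δ)
    (hΔq : Δ ≤ q + 2) (hn : 0 < n)
    (hup : L + H ≤ (p : ℝ) ^ a * (Δ : ℝ) ^ b * S + (p : ℝ) ^ (b + 1) * Δ ^ (a + 1))
    (hlow : (p.descFactorial (a + 1) : ℝ) * (q.descFactorial (b + 1) : ℝ) +
      (p.descFactorial (b + 1) : ℝ) * (q.descFactorial (a + 1) : ℝ) ≤ L) :
    (p : ℝ) ^ a * (Δ : ℝ) ^ b * (p * Δ - S) + H ≤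
      2 * ((a + b + 2 : ℕ) : ℝ) ^ 2 * (n : ℝ) ^ (a + b + 1) := by
  set k : ℕ := a + b + 2 with hk
  have hnR : (0 : ℝ) < n := by exact_mod_cast hn
  have hpR : (p : ℝ) ≤ n := by exact_mod_cast hpn
  have hΔR : (Δ : ℝ) ≤ n := by exact_mod_cast hΔn
  have hsub1 : ∀ r : ℕ, r ≤ a + b → (p : ℝ) - ((p - r : ℕ) : ℝ) ≤ k := by
    intro r hr
    rw [sub_le_iff_le_add]
    exact_mod_cast (show p ≤ k + (p - r) by omega)
  have hsub2 : ∀ r : ℕ, r ≤ a + b → (Δ : ℝ) - ((q - r : ℕ) : ℝ) ≤ k := by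
    intro r hr
    rw [sub_le_iff_le_add]
    exact_mod_cast (show Δ ≤ k + (q - r) by omega)
  have hle1 : ∀ r : ℕ, ((p - r : ℕ) : ℝ) ≤ p := fun r => by exact_mod_cast Nat.sub_le _ _
  have hle2 : ∀ r : ℕ, ((q - r : ℕ) : ℝ) ≤ Δ := fun r => by
    exact_mod_cast (Nat.sub_le _ _).trans hqΔ
  have e1 := mul_pow_mul_pow_sub_le (Nat.cast_nonneg _) (hle1 a) hpR (hsub1 a (by omega))
    (Nat.cast_nonneg _) (hle2 b) hΔR (hsub2 b (by omega)) (a + 1) (b + 1)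
  have e2 := mul_pow_mul_pow_sub_le (Nat.cast_nonneg _) (hle1 b) hpR (hsub1 b (by omega))
    (Nat.cast_nonneg _) (hle2 a) hΔR (hsub2 a (by omega)) (b + 1) (a + 1)
  have ek1 : a + 1 + (b + 1) = k := by omega
  have ek2 : b + 1 + (a + 1) = k := by omega
  have ek1R : ((a + 1 : ℕ) : ℝ) + ((b + 1 : ℕ) : ℝ) = k := by exact_mod_cast ek1
  have ek2R : ((b + 1 : ℕ) : ℝ) + ((a + 1 : ℕ) : ℝ) = k := by exact_mod_cast ek2
  rw [ek1, ek1R] at e1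
  rw [ek2, ek2R] at e2
  have f1 := mul_le_mul (pow_sub_le_descFactorial_real p a) (pow_sub_le_descFactorial_real q b)
    (by positivity) (by positivity)
  have f2 := mul_le_mul (pow_sub_le_descFactorial_real p b) (pow_sub_le_descFactorial_real q a)
    (by positivity) (by positivity)
  have g1 : (p : ℝ) ^ a * (Δ : ℝ) ^ b * (p * Δ - S) + H ≤
      ((p : ℝ) ^ (a + 1) * (Δ : ℝ) ^ (b + 1) -
        ((p - a : ℕ) : ℝ) ^ (a + 1) * ((q - b : ℕ) : ℝ) ^ (b + 1)) +
      ((p : ℝ) ^ (b + 1) * (Δ : ℝ) ^ (a + 1) -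
        ((p - b : ℕ) : ℝ) ^ (b + 1) * ((q - a : ℕ) : ℝ) ^ (a + 1)) := by
    have : (p : ℝ) ^ a * (Δ : ℝ) ^ b * (p * Δ - S) =
        (p : ℝ) ^ (a + 1) * (Δ : ℝ) ^ (b + 1) - (p : ℝ) ^ a * (Δ : ℝ) ^ b * S := by ring
    linarith
  refine le_of_mul_le_mul_left ?_ hnR
  calc (n : ℝ) * _ ≤ n * _ := mul_le_mul_of_nonneg_left g1 hnR.le
    _ ≤ k * k * (n : ℝ) ^ k + k * k * (n : ℝ) ^ k := by rw [mul_add]; exact add_le_add e1 e2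
    _ = n * (2 * k ^ 2 * (n : ℝ) ^ (a + b + 1)) := by
      have : (n : ℝ) ^ k = n * (n : ℝ) ^ (a + b + 1) := by rw [hk]; ring
      rw [this]; ring

/-- Stability: for large `n`, an extremal graph has an independent set `Y` such that `Y` and its
complement are of linear size and almost all pairs between them are edges. -/
theorem exists_almost_complete_bipartition (a b : ℕ) :
    ∃ c : ℝ, 0 < c ∧ ∀ δ : ℝ, 0 < δ → ∃ N : ℕ, ∀ (V : Type) [Fintype V] (G : SimpleGraph V),
      N ≤ Fintype.card V → IsExtremal (a + 1) (b + 1) G →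
      ∃ Y : Finset V, (∀ x ∈ Y, ∀ y ∈ Y, ¬ G.Adj x y) ∧ c * Fintype.card V ≤ #Y ∧
        c * Fintype.card V ≤ #Yᶜ ∧
        ∑ x ∈ Yᶜ, (#{y ∈ Y | ¬ G.Adj x y} : ℝ) ≤ δ * (Fintype.card V : ℝ) ^ 2 := by
  set k : ℕ := a + b + 2 with hk
  set c : ℝ := 1 / (4 * 4 ^ k) with hc
  have hc0 : 0 < c := by positivity
  refine ⟨c, hc0, fun δ hδ => ?_⟩
  set C₁ : ℝ := 2 * k ^ 2 / c ^ (a + b) with hC₁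
  set C₂ : ℝ := 2 * k ^ 2 / (δ / 2) ^ ((a + 1) * (b + 1)) with hC₂
  refine ⟨max (4 * k) (max ⌈2 / c⌉₊ (max ⌈C₁ * 2 / δ⌉₊ (⌈C₂⌉₊ + 1))), fun V _ G hN hG => ?_⟩
  simp only [max_le_iff] at hN
  obtain ⟨hN1, hN2, hN3, hN4⟩ := hN
  set n : ℕ := Fintype.card V with hn
  have hn1 : 1 ≤ n := by omega
  have hnR : (0 : ℝ) < n := by exact_mod_cast hn1
  have hNc : 2 ≤ c * n := by
    have := (Nat.ceil_le.1 hN2)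
    rw [div_le_iff₀ hc0] at this
    linarith
  have hNδ : C₁ * n ≤ δ / 2 * (n : ℝ) ^ 2 := by
    have := (Nat.ceil_le.1 hN3)
    rw [div_le_iff₀ hδ] at this
    nlinarith
  have hNC₂ : C₂ < n := (Nat.le_ceil C₂).trans_lt (by exact_mod_cast hN4)
  have hne : Nonempty V := Fintype.card_pos_iff.1 hn1
  obtain ⟨Y, Δ, hY, hYΔ, hΔY, hΔn, hΔ⟩ := exists_independent hG.1
  have hpq : #Yᶜ = n - #Y := card_compl Y
  have hYn : #Y ≤ n := card_le_univ Y
  set X : Finset V := Yᶜ with hX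
  have hup := card_bicliques_add_card_homTuples_le G a b (X := X) (Δ := Δ)
    (fun x hx y hy => hY x (by simpa [hX] using hx) y (by simpa [hX] using hy)) hΔ
  have hjen := sum_degree_pow_le G a b X
  have hlow := hG.le_card_bicliques (by omega) X
  have hbal := hG.card_div_four_pow_le (by omega)
  have hXc : #Xᶜ = #Y := by rw [hX, compl_compl]
  rw [hXc] at hlow
  have hpn : #X ≤ n := by omega
  have hXdeg : ∑ x ∈ X, #{w | G.Adj x w} ≤ #X * Δ := by
    rw [← smul_eq_mul, ← sum_const]
    exact sum_le_sum fun x _ => hΔ x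
  -- degrees split along the partition
  have hmiss : ∑ x ∈ X, #{y ∈ Y | ¬ G.Adj x y} + ∑ x ∈ X, #{w | G.Adj x w} =
      #X * #Y + ∑ x ∈ X, #{w ∈ X | G.Adj x w} := by
    rw [← sum_add_distrib, ← smul_eq_mul, ← sum_const, ← sum_add_distrib]
    refine sum_congr rfl fun x _ => ?_
    have h1 := card_filter_add_card_filter_not (s := Y) (fun y => G.Adj x y)
    have h2 : #{w | G.Adj x w} = #{w ∈ Y | G.Adj x w} + #{w ∈ X | G.Adj x w} := by
      rw [← card_union_of_disjoint (disjoint_filter_filter disjoint_compl_right),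
        ← filter_union, hX, union_compl]
    omega
  set L : ℕ := #(bicliques G (a + 1) (b + 1))
  set H : ℕ := #(homTuples G X X (a + 1) (b + 1))
  set S : ℕ := ∑ x ∈ X, #{w | G.Adj x w}
  set D : ℕ := ∑ x ∈ X, #{w ∈ X | G.Adj x w}
  have hupR : (L : ℝ) + H ≤ (#X : ℝ) ^ a * (Δ : ℝ) ^ b * S + (#X : ℝ) ^ (b + 1) * Δ ^ (a + 1) := by
    exact_mod_cast hup
  have hlowR : ((#X).descFactorial (a + 1) : ℝ) * ((#Y).descFactorial (b + 1) : ℝ) +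
      ((#X).descFactorial (b + 1) : ℝ) * ((#Y).descFactorial (a + 1) : ℝ) ≤ L := by
    exact_mod_cast hlow
  have hjenR : (D : ℝ) ^ ((a + 1) * (b + 1)) ≤ (#X : ℝ) ^ (a * (b + 1) + (a + 1) * b) * H := by
    exact_mod_cast hjen
  have hSR : (S : ℝ) ≤ #X * Δ := by exact_mod_cast hXdeg
  have hpR : (#X : ℝ) ≤ n := by exact_mod_cast hpn
  have hΔR : (Δ : ℝ) ≤ n := by exact_mod_cast hΔn
  have hp0 : (0 : ℝ) ≤ #X := by positivity
  have hΔ0 : (0 : ℝ) ≤ Δ := by positivity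
  -- the sizes of both parts are linear
  have hprod : (n : ℝ) ^ 2 ≤ 2 * 4 ^ k * (#X * Δ) := by
    have h1 : (L : ℝ) ≤ #X * Δ * (2 * (n : ℝ) ^ (a + b)) := by
      have hH : (0 : ℝ) ≤ H := by positivity
      calc (L : ℝ) ≤ (#X : ℝ) ^ a * (Δ : ℝ) ^ b * (#X * Δ) + (#X : ℝ) ^ (b + 1) * Δ ^ (a + 1) := by
            have := mul_le_mul_of_nonneg_left hSR
              (show (0 : ℝ) ≤ (#X : ℝ) ^ a * (Δ : ℝ) ^ b by positivity)
            linarith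
        _ = #X * Δ * ((#X : ℝ) ^ a * (Δ : ℝ) ^ b + (#X : ℝ) ^ b * (Δ : ℝ) ^ a) := by ring
        _ ≤ #X * Δ * ((n : ℝ) ^ a * (n : ℝ) ^ b + (n : ℝ) ^ b * (n : ℝ) ^ a) := by gcongr
        _ = _ := by ring
    have h2 : ((n : ℝ) / 4) ^ k = (n : ℝ) ^ 2 / 4 ^ k * (n : ℝ) ^ (a + b) := by
      rw [hk, div_pow]; ring
    rw [h2] at hbal
    have h3 : (n : ℝ) ^ 2 / 4 ^ k * (n : ℝ) ^ (a + b) ≤ (#X * Δ * 2) * (n : ℝ) ^ (a + b) := by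
      linarith
    have h4 := le_of_mul_le_mul_right h3 (by positivity)
    rw [div_le_iff₀ (by positivity)] at h4
    linarith
  have hcn : 2 * c * (2 * 4 ^ k) = 1 := by rw [hc]; field_simp; norm_num
  have hXlin : 2 * c * n ≤ #X := by
    have h1 : (n : ℝ) * n ≤ (2 * 4 ^ k * #X) * n := by
      calc (n : ℝ) * n = (n : ℝ) ^ 2 := by ring
        _ ≤ _ := hprod
        _ ≤ 2 * 4 ^ k * (#X * n) := by gcongr
        _ = _ := by ring
    have h2 := le_of_mul_le_mul_right h1 hnR
    calc 2 * c * n ≤ 2 * c * (2 * 4 ^ k * #X) := by gcongr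
      _ = (2 * c * (2 * 4 ^ k)) * #X := by ring
      _ = #X := by rw [hcn, one_mul]
  have hΔlin : 2 * c * n ≤ Δ := by
    have h1 : (n : ℝ) * n ≤ (2 * 4 ^ k * Δ) * n := by
      calc (n : ℝ) * n = (n : ℝ) ^ 2 := by ring
        _ ≤ _ := hprod
        _ ≤ 2 * 4 ^ k * (n * Δ) := by gcongr
        _ = _ := by ring
    have h2 := le_of_mul_le_mul_right h1 hnR
    calc 2 * c * n ≤ 2 * c * (2 * 4 ^ k * Δ) := by gcongr
      _ = (2 * c * (2 * 4 ^ k)) * Δ := by ring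
      _ = Δ := by rw [hcn, one_mul]
  have hcn0 : 0 ≤ c * n := by positivity
  -- comparison with the complete bipartite graph with parts `X` and `Y`
  have hloss : (#X : ℝ) ^ a * (Δ : ℝ) ^ b * (#X * Δ - S) + H ≤
      2 * k ^ 2 * (n : ℝ) ^ (a + b + 1) :=
    loss_le hpn hΔn hYΔ hΔY (by exact_mod_cast hn1) hupR hlowR
  have hH0 : (0 : ℝ) ≤ H := Nat.cast_nonneg _
  have hloss0 : 0 ≤ (#X : ℝ) ^ a * (Δ : ℝ) ^ b * (#X * Δ - S) :=
    mul_nonneg (by positivity) (sub_nonneg.2 hSR)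
  have hdef : (#X : ℝ) * Δ - S ≤ C₁ * n :=
    le_mul_of_pow_mul_pow_mul_le (x := (#X : ℝ)) (y := (Δ : ℝ)) hc0 hnR (by linarith)
      (by linarith) (sub_nonneg.2 hSR) (by linarith)
  have hDle : (D : ℝ) ≤ δ / 2 * (n : ℝ) ^ 2 :=
    le_mul_sq_of_pow_le (by positivity) hnR hp0 hpR (by positivity) (by linarith) hjenR hNC₂
  refine ⟨Y, hY, ?_, ?_, ?_⟩
  · have : (Δ : ℝ) ≤ #Y + 2 := by exact_mod_cast hΔY
    linarith
  · linarith
  · have h1 : ((∑ x ∈ X, #{y ∈ Y | ¬ G.Adj x y} : ℕ) : ℝ) + S = #X * #Y + D := by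
      exact_mod_cast hmiss
    rw [Nat.cast_sum] at h1
    have h2 : (#X : ℝ) * #Y ≤ #X * Δ :=
      mul_le_mul_of_nonneg_left (by exact_mod_cast hYΔ) hp0
    linarith

end Stability

section Cleaning

open scoped Classical

/-! ### From almost all vertices to all vertices -/

/-- Markov's inequality with both thresholds equal to `⌊t⌋₊`. -/
theorem card_filter_floor_lt_le {V : Type*} {s : Finset V} {f : V → ℕ} {t : ℝ} (ht : 0 ≤ t)
    (h : ∑ x ∈ s, (f x : ℝ) ≤ t ^ 2) : #{x ∈ s | ⌊t⌋₊ < f x} ≤ ⌊t⌋₊ := by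
  have h1 : #{x ∈ s | ⌊t⌋₊ < f x} * (⌊t⌋₊ + 1) ≤ ∑ x ∈ s, f x := by
    rw [← smul_eq_mul, ← sum_const]
    exact (sum_le_sum fun x hx => (mem_filter.1 hx).2).trans
      (sum_le_sum_of_subset (filter_subset _ _))
  have h2 : (#{x ∈ s | ⌊t⌋₊ < f x} : ℝ) * (⌊t⌋₊ + 1) ≤ t * (⌊t⌋₊ + 1) := by
    calc (#{x ∈ s | ⌊t⌋₊ < f x} : ℝ) * (⌊t⌋₊ + 1) ≤ ∑ x ∈ s, (f x : ℝ) := by exact_mod_cast h1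
      _ ≤ t * t := by rw [← sq]; exact h
      _ ≤ _ := mul_le_mul_of_nonneg_left (Nat.lt_floor_add_one t).le ht
  exact Nat.le_floor (le_of_mul_le_mul_right h2 (by positivity))

/-- A large extremal graph contains two disjoint independent sets of linear size, together almost all
of its vertices, such that each vertex of either is joined to almost all of the other. -/
theorem exists_good_pair (a b : ℕ) :
    ∃ c : ℝ, 0 < c ∧ ∀ ε : ℝ, 0 < ε → ε ≤ c / 8 → ∃ N : ℕ,
      ∀ (V : Type) [Fintype V] (G : SimpleGraph V),
      N ≤ Fintype.card V → IsExtremal (a + 1) (b + 1) G →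
      ∃ (P Q : Finset V) (m : ℕ), (∀ x ∈ P, ∀ y ∈ P, ¬ G.Adj x y) ∧
        (∀ x ∈ Q, ∀ y ∈ Q, ¬ G.Adj x y) ∧
        c * Fintype.card V ≤ #P ∧ c * Fintype.card V ≤ #Q ∧
        (∀ x ∈ P, #{q ∈ Q | ¬ G.Adj x q} ≤ m) ∧ (∀ y ∈ Q, #{p ∈ P | ¬ G.Adj y p} ≤ m) ∧
        #(P ∪ Q)ᶜ ≤ 3 * m ∧ 1 ≤ m ∧ (m : ℝ) ≤ ε * Fintype.card V := by
  obtain ⟨c, hc, h⟩ := exists_almost_complete_bipartition a b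
  refine ⟨c / 2, by positivity, fun ε hε hεc => ?_⟩
  obtain ⟨N, hN⟩ := h (ε ^ 2) (by positivity)
  refine ⟨max N (max ⌈8 / c⌉₊ ⌈1 / ε⌉₊), fun V _ G hn hG => ?_⟩
  simp only [max_le_iff] at hn
  obtain ⟨hn1, hn2, hn3⟩ := hn
  obtain ⟨Y, hY, hYc, hXc, hmiss⟩ := hN V G hn1 hG
  set n : ℕ := Fintype.card V with hn
  have hnc : 8 ≤ c * n := by
    have := Nat.ceil_le.1 hn2
    rw [div_le_iff₀ hc] at this
    linarith
  have hnε : 1 ≤ ε * n := by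
    have := Nat.ceil_le.1 hn3
    rw [div_le_iff₀ hε] at this
    linarith
  have hεn0 : 0 ≤ ε * n := by positivity
  have hεcn : ε * n ≤ c / 16 * n :=
    mul_le_mul_of_nonneg_right (by linarith) (Nat.cast_nonneg _)
  set m : ℕ := ⌊ε * n⌋₊ with hm
  have hmε : (m : ℝ) ≤ ε * n := Nat.floor_le hεn0
  have hm1 : 1 ≤ m := Nat.le_floor (by exact_mod_cast hnε)
  have hm1R : (1 : ℝ) ≤ m := by exact_mod_cast hm1
  rw [← mul_pow] at hmiss
  have hmiss' : ∑ y ∈ Y, (#{x ∈ Yᶜ | ¬ G.Adj y x} : ℝ) ≤ (ε * n) ^ 2 := by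
    refine le_of_eq_of_le ?_ hmiss
    have := sum_card_bipartiteAbove_eq_sum_card_bipartiteBelow (s := Yᶜ) (t := Y)
      (fun x y => ¬ G.Adj x y)
    simp only [bipartiteAbove, bipartiteBelow] at this
    have h2 : ∑ y ∈ Y, #{x ∈ Yᶜ | ¬ G.Adj y x} = ∑ x ∈ Yᶜ, #{y ∈ Y | ¬ G.Adj x y} := by
      rw [this]
      simp only [G.adj_comm]
    exact_mod_cast h2
  have hbadX := card_filter_floor_lt_le hεn0 hmiss
  have hbadY := card_filter_floor_lt_le hεn0 hmiss'
  rw [← hm] at hbadX hbadY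
  set X₁ : Finset V := {x ∈ Yᶜ | ¬ m < #{y ∈ Y | ¬ G.Adj x y}} with hX₁
  set Q : Finset V := {y ∈ Y | ¬ m < #{x ∈ Yᶜ | ¬ G.Adj y x}} with hQ
  have hX₁card := card_filter_add_card_filter_not (s := Yᶜ)
    (fun x => m < #{y ∈ Y | ¬ G.Adj x y})
  have hQcard := card_filter_add_card_filter_not (s := Y)
    (fun y => m < #{x ∈ Yᶜ | ¬ G.Adj y x})
  rw [← hX₁] at hX₁card
  rw [← hQ] at hQcard
  have hX₁good : ∀ x ∈ X₁, #{q ∈ Y | ¬ G.Adj x q} ≤ m := fun x hx =>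
    not_lt.1 (mem_filter.1 hx).2
  have hYlarge : 4 * m + 2 ≤ #Y := by
    have : (4 * m + 2 : ℝ) ≤ #Y := by linarith
    exact_mod_cast this
  -- at most one edge lies inside the good part of the complement of `Y`; one of its ends is dropped
  obtain ⟨P, hPX, hPcard, hP⟩ : ∃ P ⊆ X₁, #X₁ ≤ #P + 1 ∧ ∀ x ∈ P, ∀ y ∈ P, ¬ G.Adj x y := by
    by_cases hne : ∃ x ∈ X₁, ∃ y ∈ X₁, G.Adj x y
    · obtain ⟨x, hx, y, hy, hxy⟩ := hne
      refine ⟨X₁.erase x, erase_subset _ _, ?_, ?_⟩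
      · have := pred_card_le_card_erase (s := X₁) (a := x)
        omega
      · intro z hz w hw hzw
        rcases inner_edge_unique hG.1 hX₁good hYlarge hx hy (mem_of_mem_erase hz)
          (mem_of_mem_erase hw) hxy hzw with h | h
        · exact (ne_of_mem_erase hz) h.1.symm
        · exact (ne_of_mem_erase hw) h.1.symm
    · push Not at hne
      exact ⟨X₁, subset_rfl, by omega, hne⟩
  have hPY : P ⊆ Yᶜ := hPX.trans (filter_subset _ _)
  have hQY : Q ⊆ Y := filter_subset _ _
  have hYY : #Yᶜ + #Y = n := card_compl_add_card Y
  have hPQ : #(P ∪ Q) = #P + #Q := card_union_of_disjoint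
    (disjoint_compl_left.mono hPY hQY)
  refine ⟨P, Q, m, hP, fun x hx y hy => hY x (hQY hx) y (hQY hy), ?_, ?_, ?_, ?_, ?_, hm1, hmε⟩
  · have : (#Yᶜ : ℝ) ≤ #P + 1 + m := by exact_mod_cast (show #Yᶜ ≤ #P + 1 + m by omega)
    linarith
  · have : (#Y : ℝ) ≤ #Q + m := by exact_mod_cast (show #Y ≤ #Q + m by omega)
    linarith
  · exact fun x hx => (card_le_card (filter_subset_filter _ hQY)).trans (hX₁good x (hPX hx))
  · exact fun y hy => (card_le_card (filter_subset_filter _ hPY)).trans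
      (not_lt.1 (mem_filter.1 hy).2)
  · rw [card_compl, hPQ]
    omega

/-- A vertex of an extremal graph that has few neighbours in `P` is joined to almost all of `Q`. -/
theorem card_nonneighbors_le_mul {V : Type*} [Fintype V] {G : SimpleGraph V} {a b m K : ℕ} {c : ℝ}
    (hc : 0 < c) (hK : 12 * ((a + 1) * (b + 1)) / c ^ (a + b) ≤ (K : ℝ))
    (hG : IsExtremal (a + 1) (b + 1) G) {P Q : Finset V} (hQ : ∀ x ∈ Q, ∀ y ∈ Q, ¬ G.Adj x y)
    (hPQ : ∀ x ∈ P, #{q ∈ Q | ¬ G.Adj x q} ≤ m) (hQP : ∀ y ∈ Q, #{p ∈ P | ¬ G.Adj y p} ≤ m)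
    (hcov : #(P ∪ Q)ᶜ ≤ 3 * m) (hm : 1 ≤ m) (hn : 0 < Fintype.card V)
    (hPc : c * Fintype.card V ≤ ((#P - m - 1 - a : ℕ) : ℝ))
    (hQc : c * Fintype.card V ≤ ((#Q - 2 - a * m - b : ℕ) : ℝ)) (v : V)
    (hv : #{p ∈ P | G.Adj v p} ≤ 2 * m + 1) :
    #{q ∈ Q | ¬ G.Adj v q} ≤ (K + 1) * m := by
  have h1 := card_nonneighbors_mul_le hG v hQ hPQ hQP
  have h2 : #{w | G.Adj v w ∧ w ∉ Q} ≤ 6 * m := by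
    have hsub : ({w | G.Adj v w ∧ w ∉ Q} : Finset V) ⊆ {p ∈ P | G.Adj v p} ∪ (P ∪ Q)ᶜ := by
      intro w hw
      obtain ⟨-, hvw, hwQ⟩ := mem_filter.1 hw
      by_cases hwP : w ∈ P
      · exact mem_union_left _ (mem_filter.2 ⟨hwP, hvw⟩)
      · exact mem_union_right _ (by simp [hwP, hwQ])
    have := (card_le_card hsub).trans (card_union_le _ _)
    omega
  set n : ℕ := Fintype.card V
  set M : ℕ := #{y ∈ Q | y ≠ v ∧ ¬ G.Adj v y} with hM
  have hnR : (0 : ℝ) < n := by exact_mod_cast hn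
  have hcn : 0 ≤ c * n := by positivity
  have h3 : M * ((#P - m - 1 - a) ^ a * (#Q - 2 - a * m - b) ^ b) ≤
      12 * ((a + 1) * (b + 1)) * m * n ^ (a + b) := by
    refine h1.trans ?_
    calc _ ≤ 2 * ((a + 1) * (b + 1)) * (6 * m) * n ^ (a + b) := by gcongr
      _ = _ := by ring
  have h4 : (M : ℝ) * (((#P - m - 1 - a : ℕ) : ℝ) ^ a * ((#Q - 2 - a * m - b : ℕ) : ℝ) ^ b) ≤
      12 * ((a + 1) * (b + 1)) * m * (n : ℝ) ^ (a + b) := by exact_mod_cast h3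
  have h5 : (M : ℝ) * c ^ (a + b) * (n : ℝ) ^ (a + b) ≤
      12 * ((a + 1) * (b + 1)) * m * (n : ℝ) ^ (a + b) := by
    refine le_trans ?_ h4
    rw [mul_assoc, ← mul_pow, pow_add]
    exact mul_le_mul_of_nonneg_left (mul_le_mul (pow_le_pow_left₀ hcn hPc _)
      (pow_le_pow_left₀ hcn hQc _) (by positivity) (by positivity)) (Nat.cast_nonneg _)
  have h6 := le_of_mul_le_mul_right h5 (by positivity)
  have h7 : (M : ℝ) ≤ K * m := by
    refine le_trans ?_ (mul_le_mul_of_nonneg_right hK (Nat.cast_nonneg m))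
    rw [div_mul_eq_mul_div, le_div_iff₀ (by positivity)]
    exact h6
  have h8 : M ≤ K * m := by exact_mod_cast h7
  have h9 : ({q ∈ Q | ¬ G.Adj v q} : Finset V) ⊆ insert v {y ∈ Q | y ≠ v ∧ ¬ G.Adj v y} := by
    intro q hq
    obtain ⟨hqQ, hvq⟩ := mem_filter.1 hq
    rw [mem_insert, mem_filter]
    by_cases hqv : q = v
    · exact Or.inl hqv
    · exact Or.inr ⟨hqQ, hqv, hvq⟩
  have h10 := (card_le_card h9).trans (card_insert_le _ _)
  rw [← hM] at h10
  calc _ ≤ K * m + m := by omega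
    _ = _ := by ring

/-- A vertex with two neighbours in `P` and many in `Q` would be the centre of a bowtie. -/
theorem card_neighbors_le_or {V : Type*} [Fintype V] {G : SimpleGraph V} (hG : (book 3 1).Free G)
    {m : ℕ} {P Q : Finset V} (hPQ : ∀ x ∈ P, #{q ∈ Q | ¬ G.Adj x q} ≤ m) (v : V) :
    #{p ∈ P | G.Adj v p} ≤ 1 ∨ #{q ∈ Q | G.Adj v q} ≤ 2 * m + 1 := by
  by_contra! hcon
  obtain ⟨h1, h2⟩ := hcon
  obtain ⟨p, hp, p', hp', hpp⟩ := one_lt_card.1 h1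
  obtain ⟨hpP, hvp⟩ := mem_filter.1 hp
  obtain ⟨hpP', hvp'⟩ := mem_filter.1 hp'
  have h3 := card_le_card_common_add G {p, p'} {q ∈ Q | G.Adj v q} m (by
    intro t ht
    have htP : t ∈ P := by
      simp only [mem_insert, mem_singleton] at ht
      rcases ht with rfl | rfl <;> assumption
    exact (card_le_card (filter_subset_filter _ (filter_subset _ _))).trans (hPQ t htP))
  rw [card_pair hpp] at h3
  obtain ⟨q, hq, q', hq', hqq⟩ := Finset.one_lt_card.1
    (show 1 < #{q ∈ {q ∈ Q | G.Adj v q} | ∀ t ∈ ({p, p'} : Finset V), G.Adj t q} by omega)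
  simp only [mem_filter, mem_insert, mem_singleton, forall_eq_or_imp, forall_eq] at hq hq'
  exact false_of_bowtie hG hvp hq.1.2 hq.2.1 hvp' hq'.1.2 hq'.2.2 hpp hq'.2.1.ne hq.2.2.ne' hqq

/-- A large extremal graph has at most as many copies of `K_{a,b}` as some complete bipartite graph
with one additional edge. -/
theorem exists_completeBipartitePlusEdge_of_isExtremal (a b : ℕ) (hab : a ≤ b) :
    ∃ N : ℕ, ∀ (V : Type) [Fintype V] (G : SimpleGraph V),
      N ≤ Fintype.card V → IsExtremal (a + 1) (b + 1) G →
      ∃ T : SimpleGraph V, IsCompleteBipartitePlusEdge T ∧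
        #(bicliques G (a + 1) (b + 1)) ≤ #(bicliques T (a + 1) (b + 1)) := by
  obtain ⟨c, hc, h⟩ := exists_good_pair a b
  set K : ℕ := ⌈12 * (((a : ℝ) + 1) * (b + 1)) / (c / 2) ^ (a + b)⌉₊ with hK
  set ε : ℝ := c / (8 * (K + a + b + 1)) with hε
  have hKab : (0 : ℝ) < K + a + b + 1 := by positivity
  have hεc : ε * (8 * (K + a + b + 1)) = c := by
    rw [hε]; field_simp
  have hε0 : 0 < ε := by positivity
  obtain ⟨N, hN⟩ := h ε hε0 (by
    rw [le_div_iff₀ (by norm_num), ← hεc]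
    have : (0 : ℝ) ≤ K + a + b := by positivity
    nlinarith)
  set R : ℕ := 4 ^ (a + 1 + (b + 1)) + (a + 1) + (b + 1) + 4 with hR
  have hR4 : 0 < 4 ^ (a + 1 + (b + 1)) := by positivity
  refine ⟨max N (max 1 ⌈4 * R / c⌉₊), fun V _ G hn hG => ?_⟩
  simp only [max_le_iff] at hn
  obtain ⟨hn1, hn2, hn3⟩ := hn
  obtain ⟨P, Q, m, hP, hQ, hPc, hQc, hPQ, hQP, hcov, hm, hmε⟩ := hN V G hn1 hG
  set n : ℕ := Fintype.card V with hn
  have hnR : 4 * (R : ℝ) ≤ c * n := by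
    have := Nat.ceil_le.1 hn3
    rw [div_le_iff₀ hc] at this
    linarith
  have hmc : 8 * ((K + a + b + 1) * m : ℕ) ≤ c * n := by
    have h1 : (8 * (K + a + b + 1) : ℝ) * m ≤ 8 * (K + a + b + 1) * (ε * n) :=
      mul_le_mul_of_nonneg_left hmε (by positivity)
    have h2 : (8 * (K + a + b + 1) : ℝ) * (ε * n) = c * n := by rw [← hεc]; ring
    push_cast
    linarith
  have hlarge : ∀ S : Finset V, c * n ≤ #S → 4 * ((K + 1) * m) + R ≤ #S := by
    intro S hS
    have h1 : (K + 1) * m ≤ (K + a + b + 1) * m := Nat.mul_le_mul_right _ (by omega)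
    have h2 : (((K + 1) * m : ℕ) : ℝ) ≤ ((K + a + b + 1) * m : ℕ) := by exact_mod_cast h1
    have h3 : ((4 * ((K + 1) * m) + R : ℕ) : ℝ) ≤ #S := by
      rw [Nat.cast_add, Nat.cast_mul]
      push_cast at h2 hmc ⊢
      linarith
    exact_mod_cast h3
  have hhalf : ∀ (S : Finset V) (r : ℕ), c * n ≤ #S → r ≤ (K + a + b + 1) * m + R →
      c / 2 * n ≤ ((#S - r : ℕ) : ℝ) := by
    intro S r hS hr
    have h1 : (#S : ℝ) ≤ ((#S - r : ℕ) : ℝ) + r := by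
      exact_mod_cast (show #S ≤ #S - r + r by omega)
    have h2 : (r : ℝ) ≤ ((K + a + b + 1) * m : ℕ) + R := by exact_mod_cast hr
    linarith
  have ham : a * m ≤ (K + a + b + 1) * m := Nat.mul_le_mul_right _ (by omega)
  have h1m : 1 * m ≤ (K + a + b + 1) * m := Nat.mul_le_mul_right _ (by omega)
  have hside1 : ∀ S : Finset V, c * n ≤ #S → c / 2 * n ≤ ((#S - m - 1 - a : ℕ) : ℝ) := by
    intro S hS
    rw [Nat.sub_sub, Nat.sub_sub]
    exact hhalf S _ hS (by omega)
  have hside2 : ∀ S : Finset V, c * n ≤ #S → c / 2 * n ≤ ((#S - 2 - a * m - b : ℕ) : ℝ) := by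
    intro S hS
    rw [Nat.sub_sub, Nat.sub_sub]
    exact hhalf S _ hS (by omega)
  have hgood : ∀ v, #{q ∈ Q | ¬ G.Adj v q} ≤ (K + 1) * m ∨
      #{p ∈ P | ¬ G.Adj v p} ≤ (K + 1) * m := by
    intro v
    have hc2 : 0 < c / 2 := by positivity
    rcases card_neighbors_le_or hG.1 hPQ v with hv | hv
    · exact Or.inl (card_nonneighbors_le_mul hc2 (Nat.le_ceil _) hG hQ hPQ hQP hcov hm hn2
        (hside1 P hPc) (hside2 Q hQc) v (by omega))
    · exact Or.inr (card_nonneighbors_le_mul hc2 (Nat.le_ceil _) hG hP hQP hPQ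
        (by rwa [union_comm]) hm hn2 (hside1 Q hQc) (hside2 P hPc) v hv)
  refine exists_card_bicliques_le (m := (K + 1) * m)
    (X := {v | #{q ∈ Q | ¬ G.Adj v q} ≤ (K + 1) * m}) (P := P) (Q := Q) hG.1 (by omega) (by omega) ?_ ?_ ?_ ?_ ?_ ?_
  · intro p hp
    exact mem_filter.2 ⟨mem_univ _, (hPQ p hp).trans (Nat.le_mul_of_pos_left _ (by omega))⟩
  · intro q hq
    have : ({r ∈ Q | ¬ G.Adj q r} : Finset V) = Q :=
      filter_true_of_mem fun r hr => hQ q hq r hr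
    rw [mem_compl, mem_filter, this]
    have := hlarge Q hQc
    omega
  · exact fun x hx => (mem_filter.1 hx).2
  · exact fun y hy => (hgood y).resolve_left fun h => hy (mem_filter.2 ⟨mem_univ _, h⟩)
  · have := hlarge P hPc
    omega
  · have := hlarge Q hQc
    omega

end Cleaning

end GenTuran

theorem theorem4 (a b : ℕ) (ha : 1 ≤ a) (hab : a ≤ b) :
    ∃ n₀ : ℕ, ∀ n : ℕ, n₀ ≤ n →
      ∃ T : SimpleGraph (Fin n), GenTuran.IsCompleteBipartitePlusEdge T ∧
        GenTuran.ex n (completeBipartiteGraph (Fin a) (Fin b)) (GenTuran.book 3 1) =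
          T.copyCount (completeBipartiteGraph (Fin a) (Fin b)) := by
  classical
  obtain ⟨a, rfl⟩ : ∃ a', a = a' + 1 := ⟨a - 1, by omega⟩
  obtain ⟨b, rfl⟩ : ∃ b', b = b' + 1 := ⟨b - 1, by omega⟩
  obtain ⟨N, hN⟩ := GenTuran.exists_completeBipartitePlusEdge_of_isExtremal a b (by omega)
  refine ⟨N, fun n hn => ?_⟩
  have hbot : (GenTuran.book 3 1).Free (⊥ : SimpleGraph (Fin n)) := by
    intro h
    obtain ⟨c, x, -, -, -, hcx, -⟩ := GenTuran.book_isContained_iff.1 h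
    exact hcx
  obtain ⟨G, hG, hmax⟩ := Finset.exists_max_image
    (Finset.univ.filter fun G : SimpleGraph (Fin n) => (GenTuran.book 3 1).Free G)
    (fun G => (GenTuran.bicliques G (a + 1) (b + 1)).card)
    ⟨⊥, Finset.mem_filter.2 ⟨Finset.mem_univ _, hbot⟩⟩
  obtain ⟨T, hT, hGT⟩ := hN (Fin n) G (by simpa using hn)
    ⟨(Finset.mem_filter.1 hG).2, fun G' hG' =>
      hmax G' (Finset.mem_filter.2 ⟨Finset.mem_univ _, hG'⟩)⟩
  refine ⟨T, hT, le_antisymm ?_ ?_⟩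
  · rw [GenTuran.ex]
    refine Finset.sup_le fun G' hG' => GenTuran.copyCount_le_copyCount ((hmax G' ?_).trans hGT)
    exact Finset.mem_filter.2 ⟨Finset.mem_univ _, (Finset.mem_filter.1 hG').2⟩
  · rw [GenTuran.ex]
    exact Finset.le_sup (f := fun G : SimpleGraph (Fin n) =>
      G.copyCount (completeBipartiteGraph (Fin (a + 1)) (Fin (b + 1))))
      (Finset.mem_filter.2 ⟨Finset.mem_univ _, GenTuran.completeBipartitePlusEdge_free hT⟩)
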